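/- Let $k$ be an algebraically closed field. A finite $k$-variety is a $k$-linear category with finite direct sums and finite-dimensional Hom-spaces in which idempotents split. For such a category $\mathfrak{a}$, let $\operatorname{mod}\mathfrak{a}$ be the category of finitely presented contravariant functors from $\mathfrak{a}$ to $k$-vector spaces. One calls $\mathfrak{a}$ semi-hereditary if $\operatorname{mod}\mathfrak{a}$ is abelian and hereditary (of global dimension at most $1$), and dualizing if the pointwise dual $D(M)(x)=\operatorname{Hom}_k(M(x),k)$ restricts to a duality $\operatorname{mod}\mathfrak{a}\to\operatorname{mod}\mathfrak{a}^{\circ}$. Let $\mathfrak{a}$ be a semi-hereditary dualizing $k$-variety. A thread object is an indecomposable object $X$ having a unique direct successor and a unique direct predecessor, counted with multiplicity: the minimal almost split map $X\to M$ starting in $X$ has indecomposable target $M$, and the minimal almost split map $N\to X$ ending in $X$ has indecomposable source $N$. For indecomposable objects $X,Y$, let $[X,Y]$ be the full subcategory of those objects all of whose indecomposable direct summands $Z$ satisfy $\mathfrak{a}(X,Z)\neq 0$ and $\mathfrak{a}(Z,Y)\neq 0$. It is called a thread if each of its indecomposable objects is a thread object of $\mathfrak{a}$, and a maximal thread if moreover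 it is not properly contained in another thread. Let $\{[X_i,Y_i]\}_{i\in I}$ be any set of maximal threads in $\mathfrak{a}$, and let $\mathfrak{b}$ be the full subcategory of $\mathfrak{a}$ consisting of all objects that have no nonzero direct summand lying in one of these threads. Then $\mathfrak{b}$ is a semi-hereditary dualizing $k$-variety, and the embedding $i:\mathfrak{b}\to\mathfrak{a}$ has both a left and a right adjoint. -/

import Mathlib

open CategoryTheory CategoryTheory.Limits Opposite

universe w v u

noncomputable section

namespace DualizingVariety

/-! ### Finite varieties and their modules -/

section Modules

variable (k : Type v) [Field k] (C : Type u) [Category.{v} C] [Preadditive C] [Linear k C]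

/-- A finite `k`-variety: a `k`-linear category with finite direct sums in which idempotents
split and all of whose Hom-spaces are finite dimensional. -/
structure IsFiniteVariety : Prop where
  hasFiniteBiproducts : HasFiniteBiproducts C
  isIdempotentComplete : IsIdempotentComplete C
  finite_hom : ∀ A B : C, Module.Finite k (A ⟶ B)

/-- A right module `M` over `C` is finitely presented if it is the cokernel of a morphism between
standard projectives `C(-, A) ⟶ C(-, B)`; by the Yoneda lemma such a morphism is induced by a
morphism `A ⟶ B`. Over a variety, where finite direct sums exist and idempotents split, the
standard projectives are all the finitely generated projective modules. A functor with such a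
presentation is automatically `k`-linear, so linearity is not imposed separately. -/
def IsFinPresRight : ObjectProperty (Cᵒᵖ ⥤ ModuleCat.{v} k) := fun M =>
  ∃ (A B : C) (f : A ⟶ B) (p : (linearYoneda k C).obj B ⟶ M)
    (hp : (linearYoneda k C).map f ≫ p = 0), Nonempty (IsColimit (CokernelCofork.ofπ p hp))

/-- Finitely presented right modules over the opposite category of `C`, that is, finitely
presented covariant functors on `C`: cokernels of `C(B, -) ⟶ C(A, -)`. -/
def IsFinPresLeft : ObjectProperty (C ⥤ ModuleCat.{v} k) := fun M =>
  ∃ (A B : C) (f : A ⟶ B) (p : (linearCoyoneda k C).obj (op A) ⟶ M)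
    (hp : (linearCoyoneda k C).map f.op ≫ p = 0), Nonempty (IsColimit (CokernelCofork.ofπ p hp))

/-- The category `mod C` of finitely presented right `C`-modules. -/
abbrev FinPresRight := (IsFinPresRight k C).FullSubcategory

/-- The category `mod Cᵒᵖ` of finitely presented right `Cᵒᵖ`-modules. -/
abbrev FinPresLeft := (IsFinPresLeft k C).FullSubcategory

/-- `C` is semi-hereditary: `mod C` is abelian and hereditary (of global dimension at most one,
`Ext^i(M, N) = 0` for all `i ≥ 2`). -/
def IsSemiHereditary : Prop :=
  ∃ _ : Abelian (FinPresRight k C), ∀ M : FinPresRight k C, HasProjectiveDimensionLE M 1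

/-- The functor `D`, sending a right `C`-module `M` to the pointwise dual
`x ↦ Hom_k(M(x), k)`. -/
@[simps]
def dual : (Cᵒᵖ ⥤ ModuleCat.{v} k)ᵒᵖ ⥤ (C ⥤ ModuleCat.{v} k) where
  obj M :=
    { obj := fun x => ModuleCat.of k (Module.Dual k (M.unop.obj (op x)))
      map := fun f => ModuleCat.ofHom (M.unop.map f.op).hom.dualMap
      map_id := by intro x; ext; simp
      map_comp := by intro x y z f g; ext; simp }
  map {M N} α :=
    { app := fun x => ModuleCat.ofHom (α.unop.app (op x)).hom.dualMap
      naturality := by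
        intro x y f
        refine ModuleCat.hom_ext (LinearMap.ext fun (φ : Module.Dual k (M.unop.obj (op x))) => ?_)
        refine LinearMap.ext (M := N.unop.obj (op y)) fun m => ?_
        have h : α.unop.app (op x) (N.unop.map f.op m) = M.unop.map f.op (α.unop.app (op y) m) :=
          congrArg (fun t => t.hom m) (α.unop.naturality f.op)
        exact (congrArg φ h.symm) }
  map_id := by intro M; ext; simp
  map_comp := by intro M N P f g; ext; simp

/-- The functor `(mod C)ᵒᵖ ⥤ mod Cᵒᵖ` obtained from `D` by restriction, provided that `D`
preserves finite presentation. -/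
def dualRestrict (h : ∀ M, IsFinPresRight k C M → IsFinPresLeft k C ((dual k C).obj (op M))) :
    (FinPresRight k C)ᵒᵖ ⥤ FinPresLeft k C :=
  (IsFinPresLeft k C).lift ((IsFinPresRight k C).ι.op ⋙ dual k C) fun M => h _ M.unop.property

/-- `C` is a dualizing `k`-variety: a finite `k`-variety such that `D` induces by restriction a
duality between `mod C` and `mod Cᵒᵖ`. -/
def IsDualizing : Prop :=
  IsFiniteVariety k C ∧
    ∃ h : ∀ M, IsFinPresRight k C M → IsFinPresLeft k C ((dual k C).obj (op M)),
      (dualRestrict k C h).IsEquivalence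

end Modules

/-! ### Threads -/

section Threads

variable {C : Type u} [Category.{v} C] [Preadditive C] [HasBinaryBiproducts C]

/-- `f : X ⟶ M` is a minimal almost split map starting in `X`: it is not a split monomorphism,
every morphism from `X` which is not a split monomorphism factors through `f`, and every
endomorphism `h` of `M` with `f ≫ h = f` is invertible. -/
def IsMinimalAlmostSplitFrom {X M : C} (f : X ⟶ M) : Prop :=
  ¬ IsSplitMono f ∧ (∀ ⦃B : C⦄ (g : X ⟶ B), ¬ IsSplitMono g → ∃ h : M ⟶ B, f ≫ h = g) ∧
    ∀ h : M ⟶ M, f ≫ h = f → IsIso h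

/-- `g : N ⟶ X` is a minimal almost split map ending in `X`. -/
def IsMinimalAlmostSplitTo {N X : C} (g : N ⟶ X) : Prop :=
  ¬ IsSplitEpi g ∧ (∀ ⦃B : C⦄ (f : B ⟶ X), ¬ IsSplitEpi f → ∃ h : B ⟶ N, h ≫ g = f) ∧
    ∀ h : N ⟶ N, h ≫ g = g → IsIso h

/-- A thread object: an indecomposable object with a unique direct successor and a unique direct
predecessor (counted with multiplicity), i.e. the minimal almost split map starting in `X` has an
indecomposable target and the one ending in `X` has an indecomposable source. -/
def IsThreadObject (X : C) : Prop :=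
  Indecomposable X ∧
    (∃ (M : C) (f : X ⟶ M), Indecomposable M ∧ IsMinimalAlmostSplitFrom f) ∧
    (∃ (N : C) (g : N ⟶ X), Indecomposable N ∧ IsMinimalAlmostSplitTo g)

/-- The full replete additive subcategory `[X, Y]`: the objects all of whose indecomposable direct
summands `Z` satisfy `C(X, Z) ≠ 0` and `C(Z, Y) ≠ 0`. -/
def interval (X Y : C) : ObjectProperty C := fun A =>
  ∀ Z : C, Indecomposable Z → Nonempty (Retract Z A) →
    (∃ f : X ⟶ Z, f ≠ 0) ∧ (∃ g : Z ⟶ Y, g ≠ 0)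

/-- `[X, Y]` is a thread: `X` and `Y` are indecomposable and every indecomposable object of
`[X, Y]` is a thread object. -/
def IsThread (X Y : C) : Prop :=
  Indecomposable X ∧ Indecomposable Y ∧
    ∀ Z : C, Indecomposable Z → interval X Y Z → IsThreadObject Z

/-- `[X, Y]` is a maximal thread: it is not properly contained in another thread. -/
def IsMaximalThread (X Y : C) : Prop :=
  IsThread X Y ∧ ∀ X' Y' : C, IsThread X' Y' →
    interval X Y ≤ interval X' Y' → interval X' Y' ≤ interval X Y

/-- The objects without (indecomposable) direct summands in one of the subcategories
`[X i, Y i]`. -/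
def withoutSummandsIn {I : Type w} (X Y : I → C) : ObjectProperty C := fun A =>
  ∀ (i : I) (Z : C), Indecomposable Z → interval (X i) (Y i) Z → IsEmpty (Retract Z A)

end Threads

end DualizingVariety

end

universe u'

noncomputable section

namespace DualizingVariety

/-! Both hypotheses on the category are first turned into statements about its morphisms. Since a
cokernel of standard projectives has projective dimension at most one, the image of a map between
them is projective. So the annihilator of every morphism is generated by an idempotent
(`IsRickart`). Conversely, this condition together with weak pullbacks recovers semi-heredity. Being
dualizing amounts, given weak pushouts and weak pullbacks, to the duals of standard projectives
being finitely presented on both sides (`FinPresDualHoms`). These conditions pass to a full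
subcategory: `IsRickart` always, the conditions on one side when the inclusion has a left adjoint,
and those on the other side when it has a right adjoint. It therefore suffices to construct the two
adjoints.

`IsRickart` and finite-dimensional Hom-spaces make every indecomposable a brick, all of whose
nonzero endomorphisms are invertible, and nonzero maps composable at a brick have nonzero composite.
Objects are finite sums of bricks, so only a brick `A` in a maximal thread `[X, Y]` has to be
reflected. Its reflection is a composite of nonzero maps `A ⟶ Y ⟶ M`, where `M` is the direct
successor of `Y`. Maximality prevents `M` from being a thread object
(`IsMaximalBrickThread.not_isThreadBrick`), so `M` lies in none of the removed threads. Uniqueness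
of factorizations is the absence of zero divisors at `M`.

Existence is the core (`exists_eq_comp_of_not_isBetween`): a map from `A` to a brick outside the
thread factors through every nonzero `A ⟶ Y`. Otherwise a linear functional separates it from the
maps that factor. The functional cuts out a finitely generated subfunctor of `C(A, -)`, by duality,
and walking back along direct predecessors yields an infinite descent among the finitely many
summands of a generator.

All conditions used are self-dual or available on both sides, so coreflections are reflections in
the opposite category. For this reason modules are treated as covariant functors on `J`, with `J`
either `C` or `Cᵒᵖ`. -/

instance linearOpposite (k : Type v) [Field k] (C : Type u) [Category.{v} C] [Preadditive C]
    [Linear k C] : Linear k Cᵒᵖ where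
  homModule _ _ :=
    { smul := fun a f => (a • f.unop).op
      one_smul := fun f => Quiver.Hom.unop_inj (one_smul k f.unop)
      mul_smul := fun a b f => Quiver.Hom.unop_inj (mul_smul a b f.unop)
      smul_zero := fun a => Quiver.Hom.unop_inj (smul_zero a)
      smul_add := fun a f g => Quiver.Hom.unop_inj (smul_add a f.unop g.unop)
      add_smul := fun a b f => Quiver.Hom.unop_inj (add_smul a b f.unop)
      zero_smul := fun f => Quiver.Hom.unop_inj (zero_smul k f.unop) }
  smul_comp _ _ _ a f g := Quiver.Hom.unop_inj (Linear.comp_smul _ _ _ g.unop a f.unop)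
  comp_smul _ _ _ f a g := Quiver.Hom.unop_inj (Linear.smul_comp _ _ _ a g.unop f.unop)

/-! ### Finitely presented functors: presentations, kernels, cokernels, products -/

section Presentations

variable {k : Type v} [Field k] {J : Type u} [Category.{v} J]

theorem exact_iff_app (S : ShortComplex (J ⥤ ModuleCat.{v} k)) :
    S.Exact ↔ ∀ (j : J) (m : S.X₂.obj j), S.g.app j m = 0 → ∃ n, S.f.app j n = m := by
  constructor
  · intro h j
    exact (ShortComplex.moduleCat_exact_iff _).1 (h.map ((evaluation J (ModuleCat.{v} k)).obj j))
  · intro h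
    rw [ShortComplex.exact_iff_isZero_homology, Functor.isZero_iff]
    intro j
    have hj : (S.map ((evaluation J (ModuleCat.{v} k)).obj j)).Exact :=
      (ShortComplex.moduleCat_exact_iff _).2 (h j)
    rw [ShortComplex.exact_iff_isZero_homology] at hj
    exact hj.of_iso (S.mapHomologyIso ((evaluation J (ModuleCat.{v} k)).obj j)).symm

theorem epi_iff_app_surjective {F G : J ⥤ ModuleCat.{v} k} (p : F ⟶ G) :
    Epi p ↔ ∀ j, Function.Surjective (p.app j) := by
  rw [NatTrans.epi_iff_epi_app]
  exact forall_congr' fun j => ModuleCat.epi_iff_surjective _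

theorem mono_iff_app_injective {F G : J ⥤ ModuleCat.{v} k} (p : F ⟶ G) :
    Mono p ↔ ∀ j, Function.Injective (p.app j) := by
  rw [NatTrans.mono_iff_mono_app]
  exact forall_congr' fun j => ModuleCat.mono_iff_injective _

/-- A cokernel of functors into modules, described pointwise. -/
theorem nonempty_isColimit_cokernelCofork_iff {F G H : J ⥤ ModuleCat.{v} k} (f : F ⟶ G)
    (p : G ⟶ H) (hp : f ≫ p = 0) :
    Nonempty (IsColimit (CokernelCofork.ofπ p hp)) ↔
      (∀ j, Function.Surjective (p.app j)) ∧
        ∀ (j : J) (m : G.obj j), p.app j m = 0 → ∃ n, f.app j n = m := by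
  constructor
  · rintro ⟨h⟩
    have : Epi p := Cofork.IsColimit.epi h
    exact ⟨(epi_iff_app_surjective p).1 this,
      (exact_iff_app (ShortComplex.mk f p hp)).1 (ShortComplex.exact_of_g_is_cokernel _ h)⟩
  · rintro ⟨h₁, h₂⟩
    have : Epi (ShortComplex.mk f p hp).g := (epi_iff_app_surjective p).2 h₁
    exact ⟨((exact_iff_app (ShortComplex.mk f p hp)).2 h₂).gIsCokernel⟩

/-- A kernel of functors into modules, described pointwise. -/
theorem isLimit_kernelFork_app {F G : J ⥤ ModuleCat.{v} k} {f : F ⟶ G}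
    {c : KernelFork f} (hc : IsLimit c) :
      (∀ j, Function.Injective (c.ι.app j)) ∧
        ∀ (j : J) (m : F.obj j), f.app j m = 0 → ∃ n, c.ι.app j n = m := by
  have : Mono c.ι := Fork.IsLimit.mono hc
  refine ⟨(mono_iff_app_injective _).1 this,
    (exact_iff_app (ShortComplex.mk c.ι f c.condition)).1 ?_⟩
  refine ShortComplex.exact_of_f_is_kernel _ (hc.ofIsoLimit (Fork.ext (Iso.refl _) ?_))
  simp

theorem app_map {F G : J ⥤ ModuleCat.{v} k} (α : F ⟶ G) {X Y : J} (f : X ⟶ Y) (m : F.obj X) :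
    α.app Y (F.map f m) = G.map f (α.app X m) :=
  congrArg (fun t => t.hom m) (α.naturality f)

theorem map_comp_apply (F : J ⥤ ModuleCat.{v} k) {X Y Z : J} (f : X ⟶ Y) (g : Y ⟶ Z)
    (m : F.obj X) : F.map (f ≫ g) m = F.map g (F.map f m) := by
  simp

variable [Preadditive J] [Linear k J]

/-- The covariant functor `F` is generated by `b`, subject to the relation `f`. -/
structure IsPresentedBy (F : J ⥤ ModuleCat.{v} k) {B A : J} (f : B ⟶ A) (b : F.obj B) : Prop where
  map_add : ∀ {Z : J} (x y : B ⟶ Z), F.map (x + y) b = F.map x b + F.map y b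
  map_smul : ∀ {Z : J} (c : k) (x : B ⟶ Z), F.map (c • x) b = c • F.map x b
  surj : ∀ {Z : J} (m : F.obj Z), ∃ x : B ⟶ Z, F.map x b = m
  map_eq_zero_iff : ∀ {Z : J} (x : B ⟶ Z), F.map x b = 0 ↔ ∃ y : A ⟶ Z, x = f ≫ y

/-- The covariant functor `F` is finitely presented. -/
def FinPres : ObjectProperty (J ⥤ ModuleCat.{v} k) := fun F =>
  ∃ (B A : J) (f : B ⟶ A) (b : F.obj B), IsPresentedBy F f b

/-- Weak pushouts exist in `J`. -/
def HasWeakPushouts (J : Type u) [Category.{v} J] : Prop :=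
  ∀ ⦃X Y Z : J⦄ (f : X ⟶ Y) (g : X ⟶ Z), ∃ (P : J) (p : Y ⟶ P) (q : Z ⟶ P), f ≫ p = g ≫ q ∧
    ∀ ⦃T : J⦄ (s : Y ⟶ T) (t : Z ⟶ T), f ≫ s = g ≫ t → ∃ r : P ⟶ T, p ≫ r = s ∧ q ≫ r = t

theorem IsPresentedBy.map_sub {F : J ⥤ ModuleCat.{v} k} {B A : J} {f : B ⟶ A} {b : F.obj B}
    (h : IsPresentedBy F f b) {Z : J} (x y : B ⟶ Z) :
    F.map (x - y) b = F.map x b - F.map y b := by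
  rw [eq_sub_iff_add_eq, ← h.map_add, sub_add_cancel]

theorem IsPresentedBy.congr {F G : J ⥤ ModuleCat.{v} k} (e : F ≅ G) {B A : J} {f : B ⟶ A}
    {b : F.obj B} (h : IsPresentedBy F f b) : IsPresentedBy G f (e.hom.app B b) := by
  have inj : ∀ Z, Function.Injective (e.hom.app Z) :=
    (mono_iff_app_injective e.hom).1 inferInstance
  have surj : ∀ Z, Function.Surjective (e.hom.app Z) :=
    (epi_iff_app_surjective e.hom).1 inferInstance
  refine ⟨?_, ?_, ?_, ?_⟩
  · intro Z x y
    simp only [← app_map, h.map_add, _root_.map_add]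
  · intro Z c x
    simp only [← app_map, h.map_smul, _root_.map_smul]
  · intro Z m
    obtain ⟨m, rfl⟩ := surj Z m
    obtain ⟨x, rfl⟩ := h.surj m
    exact ⟨x, (app_map _ _ _).symm⟩
  · intro Z x
    rw [← h.map_eq_zero_iff, ← app_map]
    exact _root_.map_eq_zero_iff _ (inj Z)

instance : (FinPres (k := k) (J := J)).IsClosedUnderIsomorphisms where
  of_iso := by
    rintro F G e ⟨B, A, f, b, h⟩
    exact ⟨B, A, f, _, h.congr e⟩

/-- Lift `α` to a map `x₀` between generators. A weak pushout of `x₀` with the relations of `G`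
supplies a generator of the kernel; a second one, with the relations of `F`, supplies the relations
of that generator. -/
theorem FinPres.kernel (hJ : HasWeakPushouts J) {K F G : J ⥤ ModuleCat.{v} k} (hF : FinPres F)
    (hG : FinPres G) (α : F ⟶ G) (i : K ⟶ F) (inj : ∀ j, Function.Injective (i.app j))
    (hi : i ≫ α = 0)
    (hK : ∀ (j : J) (m : F.obj j), α.app j m = 0 → ∃ n, i.app j n = m) : FinPres K := by
  obtain ⟨B₁, A₁, f₁, b₁, h₁⟩ := hF
  obtain ⟨B₂, A₂, f₂, b₂, h₂⟩ := hG
  obtain ⟨x₀, hx₀⟩ := h₂.surj (α.app _ b₁)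
  obtain ⟨G, g, g', hg, hGu⟩ := hJ x₀ f₂
  obtain ⟨R, r, r', hr, hRu⟩ := hJ g f₁
  have hi0 : ∀ (j : J) (n : K.obj j), α.app j (i.app j n) = 0 := fun j n =>
    congrArg (fun t => (t.app j).hom n) hi
  have hα : ∀ {Z : J} (x : B₁ ⟶ Z), α.app Z (F.map x b₁) = 0 ↔ ∃ t, x₀ ≫ x = f₂ ≫ t := by
    intro Z x
    rw [app_map, ← hx₀, ← map_comp_apply]
    exact h₂.map_eq_zero_iff _
  obtain ⟨κ, hκ⟩ := hK G (F.map g b₁) ((hα g).2 ⟨_, hg⟩)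
  have hmap : ∀ {Z : J} (x : G ⟶ Z), i.app Z (K.map x κ) = F.map (g ≫ x) b₁ := by
    intro Z x
    rw [app_map, hκ, map_comp_apply]
  refine ⟨G, R, r, κ, ⟨?_, ?_, ?_, ?_⟩⟩
  · intro Z x y
    apply inj Z
    rw [_root_.map_add, hmap, hmap, hmap, Preadditive.comp_add, h₁.map_add]
  · intro Z c x
    apply inj Z
    rw [_root_.map_smul, hmap, hmap, Linear.comp_smul, h₁.map_smul]
  · intro Z m
    obtain ⟨x, hx⟩ := h₁.surj (i.app Z m)
    obtain ⟨t, ht⟩ := (hα x).1 (by rw [hx]; exact hi0 _ _)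
    obtain ⟨y, hy, -⟩ := hGu x t ht
    exact ⟨y, inj Z (by rw [hmap, hy, hx])⟩
  · intro Z x
    rw [← map_eq_zero_iff _ (inj Z), hmap, h₁.map_eq_zero_iff]
    constructor
    · rintro ⟨y, hy⟩
      obtain ⟨z, hz, -⟩ := hRu x y hy
      exact ⟨z, hz.symm⟩
    · rintro ⟨y, rfl⟩
      exact ⟨r' ≫ y, by rw [← Category.assoc, hr, Category.assoc]⟩

/-- The generator of `G` still generates; to its relations one adds the image `x₀` of the generator
of `F`. The relations of `F` play no role. -/
theorem FinPres.cokernel [HasBinaryBiproducts J] {F G Q : J ⥤ ModuleCat.{v} k} (hF : FinPres F)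
    (hG : FinPres G) (α : F ⟶ G) (p : G ⟶ Q) (surj : ∀ j, Function.Surjective (p.app j))
    (hp : α ≫ p = 0)
    (hQ : ∀ (j : J) (m : G.obj j), p.app j m = 0 → ∃ n, α.app j n = m) : FinPres Q := by
  obtain ⟨B₁, A₁, f₁, b₁, h₁⟩ := hF
  obtain ⟨B₂, A₂, f₂, b₂, h₂⟩ := hG
  obtain ⟨x₀, hx₀⟩ := h₂.surj (α.app _ b₁)
  have hp0 : ∀ (j : J) (n : F.obj j), p.app j (α.app j n) = 0 := fun j n =>
    congrArg (fun t => (t.app j).hom n) hp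
  refine ⟨B₂, B₁ ⊞ A₂, biprod.lift x₀ f₂, p.app _ b₂, ⟨?_, ?_, ?_, ?_⟩⟩
  · intro Z x y
    simp only [← app_map, h₂.map_add, _root_.map_add]
  · intro Z c x
    simp only [← app_map, h₂.map_smul, _root_.map_smul]
  · intro Z m
    obtain ⟨m, rfl⟩ := surj Z m
    obtain ⟨x, rfl⟩ := h₂.surj m
    exact ⟨x, (app_map _ _ _).symm⟩
  · intro Z x
    rw [← app_map]
    constructor
    · intro h
      obtain ⟨n, hn⟩ := hQ Z _ h
      obtain ⟨t, rfl⟩ := h₁.surj n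
      rw [app_map, ← hx₀, ← map_comp_apply, ← sub_eq_zero, ← h₂.map_sub,
        h₂.map_eq_zero_iff] at hn
      obtain ⟨s, hs⟩ := hn
      refine ⟨biprod.desc t (-s), ?_⟩
      rw [biprod.lift_desc, Preadditive.comp_neg, ← hs]
      abel
    · rintro ⟨y, rfl⟩
      have h0 : G.map (f₂ ≫ biprod.inr ≫ y) b₂ = 0 := (h₂.map_eq_zero_iff _).2 ⟨_, rfl⟩
      have : biprod.lift x₀ f₂ ≫ y = x₀ ≫ biprod.inl ≫ y + f₂ ≫ biprod.inr ≫ y := by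
        rw [biprod.lift_eq, Preadditive.add_comp, Category.assoc, Category.assoc]
      rw [this, h₂.map_add, h0, add_zero, map_comp_apply, hx₀, ← app_map]
      exact hp0 _ _

theorem FinPres.prod [HasBinaryBiproducts J] {F G P : J ⥤ ModuleCat.{v} k} (hF : FinPres F)
    (hG : FinPres G) (p : P ⟶ F) (q : P ⟶ G)
    (inj : ∀ (j : J) (m n : P.obj j), p.app j m = p.app j n → q.app j m = q.app j n → m = n)
    (surj : ∀ (j : J) (a : F.obj j) (b : G.obj j), ∃ m, p.app j m = a ∧ q.app j m = b) :
    FinPres P := by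
  obtain ⟨B₁, A₁, f₁, b₁, h₁⟩ := hF
  obtain ⟨B₂, A₂, f₂, b₂, h₂⟩ := hG
  obtain ⟨b, hb₁, hb₂⟩ := surj (B₁ ⊞ B₂) (F.map biprod.inl b₁) (G.map biprod.inr b₂)
  have hp : ∀ {Z : J} (x : B₁ ⊞ B₂ ⟶ Z), p.app Z (P.map x b) = F.map (biprod.inl ≫ x) b₁ := by
    intro Z x
    rw [app_map, hb₁, map_comp_apply]
  have hq : ∀ {Z : J} (x : B₁ ⊞ B₂ ⟶ Z), q.app Z (P.map x b) = G.map (biprod.inr ≫ x) b₂ := by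
    intro Z x
    rw [app_map, hb₂, map_comp_apply]
  refine ⟨B₁ ⊞ B₂, A₁ ⊞ A₂, biprod.map f₁ f₂, b, ⟨?_, ?_, ?_, ?_⟩⟩
  · intro Z x y
    apply inj
    · simp only [_root_.map_add, hp, Preadditive.comp_add, h₁.map_add]
    · simp only [_root_.map_add, hq, Preadditive.comp_add, h₂.map_add]
  · intro Z c x
    apply inj
    · simp only [_root_.map_smul, hp, Linear.comp_smul, h₁.map_smul]
    · simp only [_root_.map_smul, hq, Linear.comp_smul, h₂.map_smul]
  · intro Z m
    obtain ⟨x, hx⟩ := h₁.surj (p.app Z m)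
    obtain ⟨y, hy⟩ := h₂.surj (q.app Z m)
    refine ⟨biprod.desc x y, inj _ _ _ ?_ ?_⟩
    · rw [hp, biprod.inl_desc, hx]
    · rw [hq, biprod.inr_desc, hy]
  · intro Z x
    have : P.map x b = 0 ↔ p.app Z (P.map x b) = 0 ∧ q.app Z (P.map x b) = 0 := by
      constructor
      · intro h
        rw [h]
        simp
      · rintro ⟨ha, hb⟩
        apply inj
        · rw [ha, map_zero]
        · rw [hb, map_zero]
    rw [this, hp, hq, h₁.map_eq_zero_iff, h₂.map_eq_zero_iff]
    constructor
    · rintro ⟨⟨y, hy⟩, ⟨z, hz⟩⟩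
      refine ⟨biprod.desc y z, ?_⟩
      ext
      · simp [hy]
      · simp [hz]
    · rintro ⟨y, rfl⟩
      exact ⟨⟨biprod.inl ≫ y, by simp⟩, ⟨biprod.inr ≫ y, by simp⟩⟩

theorem FinPres.of_isZero [Nonempty J] {F : J ⥤ ModuleCat.{v} k} (hF : IsZero F) : FinPres F := by
  have h : ∀ (Z : J) (m n : F.obj Z), m = n := fun Z m n => by
    have := ModuleCat.subsingleton_of_isZero ((Functor.isZero_iff F).1 hF Z)
    exact Subsingleton.elim _ _
  let B : J := Classical.arbitrary J
  exact ⟨B, B, 𝟙 B, 0, ⟨fun _ _ => h _ _ _, fun _ _ => h _ _ _, fun m => ⟨0, h _ _ _⟩,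
    fun x => ⟨fun _ => ⟨x, by simp⟩, fun _ => h _ _ _⟩⟩⟩

end Presentations

/-! ### Comparison with finitely presented right and left modules -/

section

variable {k : Type v} [Field k] {C : Type u} [Category.{v} C] [Preadditive C] [Linear k C]

theorem isFinPresLeft_iff (F : C ⥤ ModuleCat.{v} k) : IsFinPresLeft k C F ↔ FinPres F := by
  constructor
  · rintro ⟨A, B, f, p, hp, h⟩
    obtain ⟨hs, he⟩ := (nonempty_isColimit_cokernelCofork_iff _ _ _).1 h
    have hb : ∀ {Z : C} (x : A ⟶ Z), F.map x (p.app A (𝟙 A)) = p.app Z x := by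
      intro Z x
      exact (app_map p x (𝟙 A)).symm.trans (congrArg (p.app Z) (Category.id_comp x))
    refine ⟨A, B, f, p.app A (𝟙 A), ⟨?_, ?_, ?_, ?_⟩⟩
    · intro Z x y
      simp only [hb]
      exact map_add (p.app Z).hom x y
    · intro Z c x
      simp only [hb]
      exact map_smul (p.app Z).hom c x
    · intro Z m
      obtain ⟨x, hx⟩ := hs Z m
      exact ⟨x, (hb x).trans hx⟩
    · intro Z x
      rw [hb]
      constructor
      · intro h
        obtain ⟨y, hy⟩ := he Z x h
        exact ⟨y, hy.symm⟩
      · rintro ⟨y, rfl⟩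
        exact congrArg (fun t => (t.app Z).hom y) hp
  · rintro ⟨A, B, f, b, h⟩
    let p : (linearCoyoneda k C).obj (op A) ⟶ F :=
      { app := fun Z => ModuleCat.ofHom
          { toFun := fun x : A ⟶ Z => F.map x b
            map_add' := h.map_add
            map_smul' := h.map_smul }
        naturality := fun Y Z g => by
          ext x
          exact map_comp_apply F x g b }
    have hp : (linearCoyoneda k C).map f.op ≫ p = 0 := by
      ext Z x
      exact (h.map_eq_zero_iff _).2 ⟨x, rfl⟩
    refine ⟨A, B, f, p, hp, (nonempty_isColimit_cokernelCofork_iff _ _ _).2 ⟨?_, ?_⟩⟩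
    · intro Z m
      exact h.surj m
    · intro Z x hx
      obtain ⟨y, hy⟩ := (h.map_eq_zero_iff _).1 hx
      exact ⟨y, hy.symm⟩

theorem isFinPresRight_iff (F : Cᵒᵖ ⥤ ModuleCat.{v} k) : IsFinPresRight k C F ↔ FinPres F := by
  constructor
  · rintro ⟨A, B, f, p, hp, h⟩
    obtain ⟨hs, he⟩ := (nonempty_isColimit_cokernelCofork_iff _ _ _).1 h
    have hb : ∀ {Z : Cᵒᵖ} (x : op B ⟶ Z), F.map x (p.app (op B) (𝟙 B)) = p.app Z x.unop := by
      intro Z x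
      exact (app_map p x (𝟙 B)).symm.trans (congrArg (p.app Z) (Category.comp_id x.unop))
    refine ⟨op B, op A, f.op, p.app (op B) (𝟙 B), ⟨?_, ?_, ?_, ?_⟩⟩
    · intro Z x y
      simp only [hb]
      exact map_add (p.app Z).hom x.unop y.unop
    · intro Z c x
      simp only [hb]
      exact map_smul (p.app Z).hom c x.unop
    · intro Z m
      obtain ⟨x, hx⟩ := hs Z m
      exact ⟨Quiver.Hom.op x, (hb (Quiver.Hom.op x)).trans hx⟩
    · intro Z x
      rw [hb]
      constructor
      · intro h
        obtain ⟨y, hy⟩ := he Z x.unop h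
        exact ⟨Quiver.Hom.op y, Quiver.Hom.unop_inj hy.symm⟩
      · rintro ⟨y, rfl⟩
        exact congrArg (fun t => (t.app Z).hom y.unop) hp
  · rintro ⟨B, A, f, b, h⟩
    let p : (linearYoneda k C).obj B.unop ⟶ F :=
      { app := fun Z => ModuleCat.ofHom
          { toFun := fun x : Z.unop ⟶ B.unop => F.map x.op b
            map_add' := fun x y => h.map_add x.op y.op
            map_smul' := fun c x => h.map_smul c x.op }
        naturality := fun Y Z g => by
          ext x
          exact map_comp_apply F (Quiver.Hom.op x) g b }
    have hp : (linearYoneda k C).map f.unop ≫ p = 0 := by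
      ext Z x
      exact (h.map_eq_zero_iff _).2 ⟨Quiver.Hom.op x, rfl⟩
    refine ⟨A.unop, B.unop, f.unop, p, hp,
      (nonempty_isColimit_cokernelCofork_iff _ _ _).2 ⟨?_, ?_⟩⟩
    · intro Z m
      obtain ⟨x, hx⟩ := h.surj m
      exact ⟨x.unop, hx⟩
    · intro Z x hx
      obtain ⟨y, hy⟩ := (h.map_eq_zero_iff (Quiver.Hom.op x)).1 hx
      exact ⟨y.unop, congrArg Quiver.Hom.unop hy.symm⟩

end

/-! ### Closure properties that make the finitely presented functors abelian -/

section Closure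

variable {k : Type v} [Field k] {J : Type u} [Category.{v} J] [Preadditive J] [Linear k J]

instance [Nonempty J] : (FinPres (k := k) (J := J)).ContainsZero where
  exists_zero :=
    have ⟨F, hF⟩ := HasZeroObject.zero (C := J ⥤ ModuleCat.{v} k)
    ⟨F, hF, FinPres.of_isZero hF⟩

theorem isClosedUnderKernels_finPres (hJ : HasWeakPushouts J) :
    (FinPres (k := k) (J := J)).IsClosedUnderKernels where
  kernels_le := by
    intro _ ⟨f, c, hc, hf⟩
    obtain ⟨h₁, h₂⟩ := isLimit_kernelFork_app hc
    exact FinPres.kernel hJ hf.1 hf.2 f c.ι h₁ c.condition h₂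

instance [HasBinaryBiproducts J] : (FinPres (k := k) (J := J)).IsClosedUnderCokernels where
  cokernels_le := by
    intro _ ⟨f, c, hc, hf⟩
    obtain ⟨h₁, h₂⟩ := (nonempty_isColimit_cokernelCofork_iff f c.π c.condition).1
      ⟨hc.ofIsoColimit (Cofork.ext (Iso.refl _) (by simp))⟩
    exact FinPres.cokernel hf.1 hf.2 f c.π h₁ c.condition h₂

theorem FinPres.biprod [HasBinaryBiproducts J] {F G : J ⥤ ModuleCat.{v} k} (hF : FinPres F)
    (hG : FinPres G) : FinPres (F ⊞ G) := by
  have total : ∀ (j : J) (m : (F ⊞ G).obj j), (biprod.inl : F ⟶ F ⊞ G).app j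
      ((biprod.fst : F ⊞ G ⟶ F).app j m) + (biprod.inr : G ⟶ F ⊞ G).app j
      ((biprod.snd : F ⊞ G ⟶ G).app j m) = m := fun j m =>
    congrArg (fun t => (t.app j).hom m) (biprod.total (X := F) (Y := G))
  refine FinPres.prod hF hG biprod.fst biprod.snd ?_ ?_
  · intro j m n h₁ h₂
    rw [← total j m, h₁, h₂, total]
  · intro j a b
    have h₁ : (biprod.fst : F ⊞ G ⟶ F).app j ((biprod.inl : F ⟶ F ⊞ G).app j a) = a :=
      congrArg (fun t => (t.app j).hom a) (biprod.inl_fst (X := F) (Y := G))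
    have h₂ : (biprod.snd : F ⊞ G ⟶ G).app j ((biprod.inl : F ⟶ F ⊞ G).app j a) = 0 :=
      congrArg (fun t => (t.app j).hom a) (biprod.inl_snd (X := F) (Y := G))
    have h₃ : (biprod.fst : F ⊞ G ⟶ F).app j ((biprod.inr : G ⟶ F ⊞ G).app j b) = 0 :=
      congrArg (fun t => (t.app j).hom b) (biprod.inr_fst (X := F) (Y := G))
    have h₄ : (biprod.snd : F ⊞ G ⟶ G).app j ((biprod.inr : G ⟶ F ⊞ G).app j b) = b :=
      congrArg (fun t => (t.app j).hom b) (biprod.inr_snd (X := F) (Y := G))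
    refine ⟨(biprod.inl : F ⟶ F ⊞ G).app j a + (biprod.inr : G ⟶ F ⊞ G).app j b, ?_, ?_⟩
    · rw [map_add, h₁, h₃, add_zero]
    · rw [map_add, h₂, h₄, zero_add]

instance [HasBinaryBiproducts J] : (FinPres (k := k) (J := J)).IsClosedUnderBinaryProducts where
  limitsOfShape_le := by
    rintro X ⟨p⟩
    have h := FinPres.biprod (p.prop_diag_obj ⟨.left⟩) (p.prop_diag_obj ⟨.right⟩)
    exact (FinPres (k := k) (J := J)).prop_of_iso
      (IsLimit.conePointsIsoOfNatIso p.isLimit (BinaryBiproduct.isLimit _ _)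
        (diagramIsoPair _)).symm h

instance [Nonempty J] [HasBinaryBiproducts J] :
    (FinPres (k := k) (J := J)).IsClosedUnderFiniteProducts :=
  ObjectProperty.IsClosedUnderFiniteProducts.mk'

end Closure

/-! ### Semi-heredity as a condition on annihilators -/

section Rickart

variable {k : Type v} [Field k] {C : Type u} [Category.{v} C] [Preadditive C]

/-- The annihilator of every morphism is generated by an idempotent, so that images of morphisms
between standard projectives are projective. -/
def IsRickart (C : Type u) [Category.{v} C] [Preadditive C] : Prop :=
  ∀ ⦃A B : C⦄ (f : A ⟶ B), ∃ e : A ⟶ A, e ≫ f = f ∧ ∀ ⦃Z : C⦄ (x : Z ⟶ A), x ≫ f = 0 → x ≫ e = 0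

variable [Linear k C]

theorem isFinPresRight_eq : IsFinPresRight k C = FinPres := by
  ext F
  exact isFinPresRight_iff F

theorem linearYoneda_hom_ext {B : C} {F : Cᵒᵖ ⥤ ModuleCat.{v} k}
    {α β : (linearYoneda k C).obj B ⟶ F}
    (h : α.app (op B) (𝟙 B : B ⟶ B) = β.app (op B) (𝟙 B : B ⟶ B)) : α = β := by
  ext Z x
  have key : ∀ γ : (linearYoneda k C).obj B ⟶ F,
      γ.app Z x = F.map (Quiver.Hom.op x) (γ.app (op B) (𝟙 B : B ⟶ B)) := fun γ =>
    (congrArg (γ.app Z) (Category.comp_id x).symm).trans (app_map γ (Quiver.Hom.op x) (𝟙 B : B ⟶ B))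
  exact (key α).trans ((congrArg (F.map (Quiver.Hom.op x)) h).trans (key β).symm)

theorem isFinPresRight_linearYoneda (B : C) : IsFinPresRight k C ((linearYoneda k C).obj B) := by
  rw [isFinPresRight_iff]
  refine ⟨op B, op B, 0, (𝟙 B : B ⟶ B), ⟨?_, ?_, ?_, ?_⟩⟩
  · intro Z x y
    exact Preadditive.add_comp _ _ _ x.unop y.unop (𝟙 B)
  · intro Z c x
    exact Linear.smul_comp _ _ _ c x.unop (𝟙 B)
  · intro Z m
    exact ⟨Quiver.Hom.op m, Category.comp_id (obj := C) m⟩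
  · intro Z x
    have : ((linearYoneda k C).obj B).map x (𝟙 B : B ⟶ B) = x.unop := Category.comp_id x.unop
    rw [this]
    constructor
    · intro h
      exact ⟨0, Quiver.Hom.unop_inj (h.trans (by rw [comp_zero]; rfl))⟩
    · rintro ⟨y, rfl⟩
      rw [zero_comp]
      rfl

/-- The standard projective right module, as an object of `mod C`. -/
def standardProjective (k : Type v) [Field k] [Linear k C] (B : C) : FinPresRight k C :=
  ⟨(linearYoneda k C).obj B, isFinPresRight_linearYoneda B⟩

/-- The morphism between standard projectives induced by a morphism of `C`. -/
def standardProjectiveMap (k : Type v) [Field k] [Linear k C] {A B : C} (f : A ⟶ B) :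
    standardProjective k A ⟶ standardProjective k B :=
  ObjectProperty.homMk ((linearYoneda k C).map f)

theorem exists_standardProjectiveMap_eq {A B : C}
    (α : standardProjective k A ⟶ standardProjective k B) :
    ∃ f : A ⟶ B, α = standardProjectiveMap k f := by
  refine ⟨α.hom.app (op A) (𝟙 A : A ⟶ A), ?_⟩
  ext1
  apply linearYoneda_hom_ext
  exact (Category.id_comp (obj := C) _).symm

theorem standardProjectiveMap_injective {A B : C} {f g : A ⟶ B}
    (h : standardProjectiveMap k f = standardProjectiveMap k g) : f = g := by
  have h' : (𝟙 A : A ⟶ A) ≫ f = (𝟙 A : A ⟶ A) ≫ g :=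
    congrArg (fun t => (t.hom.app (op A)).hom (𝟙 A : A ⟶ A)) h
  simpa using h'

theorem standardProjectiveMap_comp {A B D : C} (f : A ⟶ B) (g : B ⟶ D) :
    standardProjectiveMap k (f ≫ g) = standardProjectiveMap k f ≫ standardProjectiveMap k g := by
  ext1
  exact (linearYoneda k C).map_comp f g

/-- The pointwise cokernel is again finitely presented, so an epimorphism of `mod C` already has
zero cokernel among all functors. -/
theorem finPresRight_epi_surjective [HasBinaryBiproducts C] {M N : FinPresRight k C} (p : M ⟶ N)
    [Epi p] (j : Cᵒᵖ) : Function.Surjective (p.hom.app j) := by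
  have hQ : IsFinPresRight k C (cokernel p.hom) := by
    have h : FinPres (cokernel p.hom) :=
      FinPres.prop_cokernel p.hom ((isFinPresRight_iff _).1 M.property)
        ((isFinPresRight_iff _).1 N.property)
    exact (isFinPresRight_iff _).2 h
  let π : N ⟶ (⟨cokernel p.hom, hQ⟩ : FinPresRight k C) := ObjectProperty.homMk (cokernel.π p.hom)
  let z : N ⟶ (⟨cokernel p.hom, hQ⟩ : FinPresRight k C) := ObjectProperty.homMk 0
  have hπ : π = z := by
    rw [← cancel_epi p]
    ext1
    change p.hom ≫ cokernel.π p.hom = p.hom ≫ 0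
    simp
  have h0 : cokernel.π p.hom = 0 := congrArg (fun t => t.hom) hπ
  have : Epi p.hom := Preadditive.epi_of_cokernel_zero h0
  exact (epi_iff_app_surjective p.hom).1 this j

theorem projective_standardProjective [HasBinaryBiproducts C] (B : C) :
    Projective (standardProjective k B) where
  factors := by
    intro N M t p _
    obtain ⟨m, hm⟩ := finPresRight_epi_surjective p (op B) (t.hom.app (op B) (𝟙 B : B ⟶ B))
    obtain ⟨A', B', f, q, hq, hc⟩ := N.property
    obtain ⟨x, hx⟩ := ((nonempty_isColimit_cokernelCofork_iff _ _ _).1 hc).1 (op B) m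
    refine ⟨ObjectProperty.homMk ((linearYoneda k C).map x ≫ q), ?_⟩
    ext1
    apply linearYoneda_hom_ext
    refine Eq.trans ?_ hm
    refine congrArg (p.hom.app (op B)) ?_
    refine Eq.trans ?_ hx
    exact congrArg (q.app (op B)) (Category.id_comp (obj := C) x)

/-- The image of `f` is a first syzygy of the cokernel, hence projective, and `e` is the projection
of `P` onto a split copy of it. The annihilation property is phrased with two parallel maps so that
it mentions no zero morphism, which would refer to the additive structure carried by the abelian
instance. -/
theorem exists_idempotent_of_hasProjectiveDimensionLE {D : Type*} [Category* D] [Abelian D]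
    {P Q : D} [Projective Q] (f : P ⟶ Q) (h : HasProjectiveDimensionLE (cokernel f) 1) :
    ∃ e : P ⟶ P, e ≫ f = f ∧ ∀ ⦃Z : D⦄ (x y : Z ⟶ P), x ≫ f = y ≫ f → x ≫ e = y ≫ e := by
  let S : ShortComplex D := ShortComplex.mk (kernel.ι (cokernel.π f)) (cokernel.π f) (by simp)
  have hS : S.ShortExact :=
    { exact := ShortComplex.exact_of_f_is_kernel _ (kernelIsKernel (cokernel.π f))
      mono_f := inferInstanceAs (Mono (kernel.ι (cokernel.π f)))
      epi_g := inferInstanceAs (Epi (cokernel.π f)) }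
  have h₁ : HasProjectiveDimensionLT S.X₁ 1 :=
    hS.hasProjectiveDimensionLT_X₁ 1 (inferInstanceAs (HasProjectiveDimensionLT Q 1)) h
  have : Projective (Abelian.image f) := inferInstanceAs (Projective S.X₁)
  refine ⟨Abelian.factorThruImage f ≫ Projective.factorThru (𝟙 _) (Abelian.factorThruImage f),
    ?_, ?_⟩
  · calc _ = (Abelian.factorThruImage f ≫ Projective.factorThru (𝟙 _) (Abelian.factorThruImage f)) ≫
          Abelian.factorThruImage f ≫ Abelian.image.ι f := by rw [Abelian.image.fac]
      _ = f := by rw [Category.assoc, Projective.factorThru_comp_assoc, Category.id_comp,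
          Abelian.image.fac]
  · intro Z x y hxy
    have : x ≫ Abelian.factorThruImage f = y ≫ Abelian.factorThruImage f := by
      rw [← cancel_mono (Abelian.image.ι f)]
      simpa using hxy
    rw [← Category.assoc, this, Category.assoc]

theorem IsSemiHereditary.isRickart [HasBinaryBiproducts C] (h : IsSemiHereditary k C) :
    IsRickart C := by
  obtain ⟨_, hpd⟩ := h
  intro A B f
  have := projective_standardProjective (k := k) B
  obtain ⟨e, he, hu⟩ :=
    exists_idempotent_of_hasProjectiveDimensionLE (standardProjectiveMap k f) (hpd _)
  obtain ⟨e, rfl⟩ := exists_standardProjectiveMap_eq e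
  refine ⟨e, ?_, ?_⟩
  · rw [← standardProjectiveMap_comp] at he
    exact standardProjectiveMap_injective he
  · intro Z x hx
    have := hu (standardProjectiveMap k x) (standardProjectiveMap k 0) (by
      rw [← standardProjectiveMap_comp, ← standardProjectiveMap_comp, hx, zero_comp])
    rw [← standardProjectiveMap_comp, ← standardProjectiveMap_comp] at this
    rw [standardProjectiveMap_injective this, zero_comp]

/-- Weak pushouts in `Cᵒᵖ` give kernels in `mod C`. Splitting `e` replaces `f` by the monomorphism
`i ≫ f` with the same image, so each module has a projective resolution of length one. -/
theorem IsRickart.isSemiHereditary [Nonempty C] [HasBinaryBiproducts C] [IsIdempotentComplete C]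
    (hC : IsRickart C) (hw : HasWeakPushouts Cᵒᵖ) : IsSemiHereditary k C := by
  have : (IsFinPresRight k C).ContainsZero := by rw [isFinPresRight_eq]; infer_instance
  have : (IsFinPresRight k C).IsClosedUnderKernels := by
    rw [isFinPresRight_eq]; exact isClosedUnderKernels_finPres hw
  have : (IsFinPresRight k C).IsClosedUnderCokernels := by rw [isFinPresRight_eq]; infer_instance
  have : (IsFinPresRight k C).IsClosedUnderFiniteProducts := by
    rw [isFinPresRight_eq]; infer_instance
  refine ⟨inferInstance, fun M => ?_⟩
  obtain ⟨A, B, f, p, hp, hc⟩ := M.property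
  obtain ⟨hsurj, hex⟩ := (nonempty_isColimit_cokernelCofork_iff _ _ _).1 hc
  obtain ⟨e, hef, hez⟩ := hC f
  have hee : e ≫ e = e := by
    have := hez (𝟙 A - e) (by simp [hef])
    rw [Preadditive.sub_comp, Category.id_comp, sub_eq_zero] at this
    exact this.symm
  obtain ⟨A', i, r, hir, hri⟩ := IsIdempotentComplete.idempotents_split A e hee
  have hg : ∀ {Z : C} (x : Z ⟶ A), x ≫ f = (x ≫ r) ≫ i ≫ f := by
    intro Z x
    rw [Category.assoc, reassoc_of% hri, hef]
  have hmono : ∀ {Z : C} (x : Z ⟶ A'), x ≫ i ≫ f = 0 → x = 0 := by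
    intro Z x hx
    have := hez (x ≫ i) (by simpa using hx)
    calc x = ((x ≫ i) ≫ e) ≫ r := by rw [← hri]; simp [hir]
      _ = 0 := by rw [this, zero_comp]
  have hp' : (linearYoneda k C).map (i ≫ f) ≫ p = 0 := by
    rw [Functor.map_comp, Category.assoc, hp, comp_zero]
  let P : FinPresRight k C := standardProjective k B
  let π : P ⟶ M := ObjectProperty.homMk p
  have hw : standardProjectiveMap k (i ≫ f) ≫ π = 0 := by
    ext1
    exact hp'
  have hcol : Nonempty (IsColimit (CokernelCofork.ofπ p hp')) := by
    refine (nonempty_isColimit_cokernelCofork_iff _ _ _).2 ⟨hsurj, fun j m hm => ?_⟩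
    obtain ⟨n, hn⟩ := hex j m hm
    exact ⟨(show j.unop ⟶ A from n) ≫ r, (hg (show j.unop ⟶ A from n)).symm.trans hn⟩
  have hcol' : IsColimit (CokernelCofork.ofπ π hw) :=
    isColimitOfReflects (IsFinPresRight k C).ι
      ((CokernelCofork.isColimitMapCoconeEquiv _ _).symm hcol.some)
  let S : ShortComplex (FinPresRight k C) := ShortComplex.mk (standardProjectiveMap k (i ≫ f)) π hw
  have hmono' : Mono S.f := by
    have : Mono S.f.hom := by
      rw [mono_iff_app_injective]
      intro j
      refine (injective_iff_map_eq_zero (S.f.hom.app j).hom).2 fun x hx => hmono x hx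
    exact (IsFinPresRight k C).ι.mono_of_mono_map this
  have hS : S.ShortExact :=
    { exact := ShortComplex.exact_of_g_is_cokernel _ hcol'
      mono_f := hmono'
      epi_g := Cofork.IsColimit.epi hcol' }
  have h₁ := projective_standardProjective (k := k) A'
  have h₂ := projective_standardProjective (k := k) B
  exact hS.hasProjectiveDimensionLT_X₃ 1
    (inferInstanceAs (HasProjectiveDimensionLT (standardProjective k A') 1))
    (inferInstanceAs (HasProjectiveDimensionLT (standardProjective k B) 2))

end Rickart

/-! ### Weak pushouts and duals of standard projectives -/

section

variable (k : Type v) [Field k] (J : Type u) [Category.{v} J] [Preadditive J] [Linear k J]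

/-- The covariant functors `D(J(-, W))` dual to the standard projectives are finitely presented. -/
def FinPresDualHoms : Prop :=
  ∀ W : J, ∃ (B A : J) (f : B ⟶ A) (β : (B ⟶ W) →ₗ[k] k),
    (∀ ⦃Z : J⦄ (φ : (Z ⟶ W) →ₗ[k] k), ∃ x : B ⟶ Z, ∀ g : Z ⟶ W, φ g = β (x ≫ g)) ∧
      ∀ ⦃Z : J⦄ (x : B ⟶ Z), (∀ g : Z ⟶ W, β (x ≫ g) = 0) ↔ ∃ y : A ⟶ Z, x = f ≫ y

end

section

variable {k : Type v} [Field k]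

/-- In `C` this asks for weak pullbacks: `𝟙 - e` is a weak kernel of the difference map `Y ⊞ Z ⟶ X`,
where `e` is the idempotent attached to it. -/
theorem IsRickart.hasWeakPushouts_op {C : Type u} [Category.{v} C] [Preadditive C]
    [HasBinaryBiproducts C] (hC : IsRickart C) : HasWeakPushouts Cᵒᵖ := by
  intro X Y Z f g
  obtain ⟨e, he, hu⟩ := hC (biprod.desc f.unop (-g.unop))
  have h0 : (𝟙 _ - e) ≫ biprod.desc f.unop (-g.unop) = 0 := by
    rw [Preadditive.sub_comp, he, Category.id_comp, sub_self]
  refine ⟨op (Y.unop ⊞ Z.unop), ((𝟙 _ - e) ≫ biprod.fst).op, ((𝟙 _ - e) ≫ biprod.snd).op, ?_, ?_⟩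
  · apply Quiver.Hom.unop_inj
    rw [biprod.desc_eq, Preadditive.comp_neg, ← sub_eq_add_neg, Preadditive.comp_sub,
      sub_eq_zero] at h0
    simpa using h0
  · intro T s t hst
    have hst' : s.unop ≫ f.unop = t.unop ≫ g.unop := congrArg Quiver.Hom.unop hst
    have h1 := hu (biprod.lift s.unop t.unop) (by simp [hst'])
    refine ⟨(biprod.lift s.unop t.unop).op, ?_, ?_⟩
    · apply Quiver.Hom.unop_inj
      simp [Preadditive.sub_comp, reassoc_of% h1]
    · apply Quiver.Hom.unop_inj
      simp [Preadditive.sub_comp, reassoc_of% h1]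

section

variable {J : Type u} [Category.{v} J] [Preadditive J] [Linear k J]

theorem FinPres.finite_obj (hJ : ∀ A B : J, Module.Finite k (A ⟶ B)) {F : J ⥤ ModuleCat.{v} k}
    (hF : FinPres F) (Z : J) : Module.Finite k (F.obj Z) := by
  obtain ⟨B, A, f, b, h⟩ := hF
  have := hJ B Z
  let p : (B ⟶ Z) →ₗ[k] F.obj Z :=
    { toFun := fun x => F.map x b
      map_add' := h.map_add
      map_smul' := h.map_smul }
  exact Module.Finite.of_surjective p h.surj

end

variable {C : Type u} [Category.{v} C] [Preadditive C] [Linear k C]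

theorem isFinPresLeft_linearCoyoneda (B : C) :
    IsFinPresLeft k C ((linearCoyoneda k C).obj (op B)) := by
  rw [isFinPresLeft_iff]
  refine ⟨B, B, 0, (𝟙 B : B ⟶ B), ⟨?_, ?_, ?_, ?_⟩⟩
  · intro Z x y
    exact Preadditive.comp_add _ _ _ (𝟙 B) x y
  · intro Z c x
    exact Linear.comp_smul _ _ _ (𝟙 B) c x
  · intro Z m
    exact ⟨m, Category.id_comp (obj := C) m⟩
  · intro Z x
    have : ((linearCoyoneda k C).obj (op B)).map x (𝟙 B : B ⟶ B) = x := Category.id_comp x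
    rw [this]
    constructor
    · intro h
      exact ⟨0, h.trans (by rw [comp_zero]; rfl)⟩
    · rintro ⟨y, rfl⟩
      rw [zero_comp]
      rfl

/-- The standard projective left module, as an object of `mod Cᵒᵖ`. -/
def standardProjectiveLeft (k : Type v) [Field k] [Linear k C] (B : C) : FinPresLeft k C :=
  ⟨(linearCoyoneda k C).obj (op B), isFinPresLeft_linearCoyoneda B⟩

theorem hasWeakPushouts_of_hasEqualizers [HasBinaryBiproducts C]
    [HasEqualizers (FinPresLeft k C)] : HasWeakPushouts C := by
  intro X Y Z f g
  let F : ∀ {A B : C}, (A ⟶ B) → (standardProjectiveLeft k B ⟶ standardProjectiveLeft k A) :=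
    fun f => ObjectProperty.homMk ((linearCoyoneda k C).map f.op)
  have F_comp : ∀ {A B D : C} (f : A ⟶ B) (g : B ⟶ D), F g ≫ F f = F (f ≫ g) := fun f g => by
    ext1
    exact ((linearCoyoneda k C).map_comp g.op f.op).symm
  -- By Yoneda, maps into this equalizer from a standard projective are the maps `Y ⊞ Z ⟶ T` that
  -- agree on `X`. A generator of the equalizer is thus a weak pushout.
  let c := equalizer.ι (F (f ≫ (biprod.inl : Y ⟶ Y ⊞ Z))) (F (g ≫ (biprod.inr : Z ⟶ Y ⊞ Z)))
  have hc : c ≫ _ = c ≫ _ := equalizer.condition _ _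
  obtain ⟨G, A, r, κ, hκ⟩ := (isFinPresLeft_iff _).1
    (equalizer (F (f ≫ (biprod.inl : Y ⟶ Y ⊞ Z))) (F (g ≫ (biprod.inr : Z ⟶ Y ⊞ Z)))).property
  let d : Y ⊞ Z ⟶ G := c.hom.app G κ
  refine ⟨G, biprod.inl ≫ d, biprod.inr ≫ d, ?_, ?_⟩
  · have : (f ≫ biprod.inl) ≫ d = (g ≫ biprod.inr) ≫ d :=
      congrArg (fun t => (t.hom.app G).hom κ) hc
    simpa using this
  · intro T s t hst
    have hs : F (biprod.desc s t) ≫ F (f ≫ biprod.inl) =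
        F (biprod.desc s t) ≫ F (g ≫ biprod.inr) := by
      rw [F_comp, F_comp]
      congr 1
      simpa using hst
    obtain ⟨x, hx⟩ := hκ.surj ((equalizer.lift _ hs).hom.app T (𝟙 T : T ⟶ T))
    have hl : equalizer.lift _ hs ≫ c = F (biprod.desc s t) := equalizer.lift_ι _ _
    have : d ≫ x = biprod.desc s t := by
      have h₁ : c.hom.app T ((equalizer.lift _ hs).hom.app T (𝟙 T : T ⟶ T)) =
          biprod.desc s t ≫ 𝟙 T := congrArg (fun u => (u.hom.app T).hom (𝟙 T : T ⟶ T)) hl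
      rw [← hx, app_map, Category.comp_id] at h₁
      exact h₁
    refine ⟨x, ?_, ?_⟩
    · rw [Category.assoc, this, biprod.inl_desc]
    · rw [Category.assoc, this, biprod.inr_desc]

/-- The duality carries the coequalizers of the abelian category `mod C` to equalizers in `mod Cᵒᵖ`.
-/
theorem IsDualizing.hasWeakPushouts [HasBinaryBiproducts C] (hd : IsDualizing k C)
    (hs : IsSemiHereditary k C) : HasWeakPushouts C := by
  obtain ⟨_, h, _⟩ := hd
  obtain ⟨_, -⟩ := hs
  have : HasCoequalizers (FinPresRight k C) := inferInstance
  have : HasEqualizers (FinPresRight k C)ᵒᵖ := hasEqualizers_opposite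
  have : HasEqualizers (FinPresLeft k C) :=
    Adjunction.hasLimitsOfShape_of_equivalence (dualRestrict k C h).inv
  exact hasWeakPushouts_of_hasEqualizers (k := k)

theorem finPresDualHoms_iff : FinPresDualHoms k C ↔
    ∀ W : C, FinPres ((dual k C).obj (op ((linearYoneda k C).obj W))) := by
  refine forall_congr' fun W => ?_
  constructor
  · rintro ⟨B, A, f, β, h₁, h₂⟩
    refine ⟨B, A, f, β, ⟨?_, ?_, ?_, ?_⟩⟩
    · intro Z x y
      refine LinearMap.ext fun g : Z ⟶ W => ?_
      exact (congrArg β (Preadditive.add_comp _ _ _ x y g)).trans (map_add β _ _)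
    · intro Z c x
      refine LinearMap.ext fun g : Z ⟶ W => ?_
      exact (congrArg β (Linear.smul_comp _ _ _ c x g)).trans (map_smul β _ _)
    · intro Z φ
      obtain ⟨x, hx⟩ := h₁ φ
      exact ⟨x, LinearMap.ext fun g : Z ⟶ W => (hx g).symm⟩
    · intro Z x
      rw [← h₂]
      constructor
      · intro h g
        exact DFunLike.congr_fun (F := Module.Dual k (Z ⟶ W)) h g
      · intro h
        exact LinearMap.ext fun g : Z ⟶ W => h g
  · rintro ⟨B, A, f, β, h⟩
    refine ⟨B, A, f, β, ?_, ?_⟩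
    · intro Z φ
      obtain ⟨x, hx⟩ := h.surj (Z := Z) φ
      exact ⟨x, fun g => (DFunLike.congr_fun (F := Module.Dual k (Z ⟶ W)) hx g).symm⟩
    · intro Z x
      rw [← h.map_eq_zero_iff]
      constructor
      · intro h
        exact LinearMap.ext fun g : Z ⟶ W => h g
      · intro h g
        exact DFunLike.congr_fun (F := Module.Dual k (Z ⟶ W)) h g

theorem IsDualizing.finPresDualHoms (hd : IsDualizing k C) : FinPresDualHoms k C := by
  obtain ⟨_, h, _⟩ := hd
  rw [finPresDualHoms_iff]
  intro W
  exact (isFinPresLeft_iff _).1 (h _ (isFinPresRight_linearYoneda W))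

theorem finite_hom_op (hC : ∀ A B : C, Module.Finite k (A ⟶ B)) (A B : Cᵒᵖ) :
    Module.Finite k (A ⟶ B) := by
  have := hC B.unop A.unop
  let e : (B.unop ⟶ A.unop) →ₗ[k] (A ⟶ B) :=
    { toFun := fun f => f.op
      map_add' := fun _ _ => rfl
      map_smul' := fun _ _ => rfl }
  exact Module.Finite.of_surjective e fun f => ⟨f.unop, rfl⟩

/-- Essential surjectivity writes `C(W, -)` as the dual of some finitely presented `M`. Pointwise
reflexivity identifies the dual of `C(W, -)` with `M`, and the functional sought is evaluation at
the generator of `M`. -/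
theorem IsDualizing.finPresDualHoms_op (hd : IsDualizing k C) : FinPresDualHoms k Cᵒᵖ := by
  obtain ⟨hfin, h, heq⟩ := hd
  intro W
  let M := (dualRestrict k C h).objPreimage (standardProjectiveLeft k W.unop)
  have e : (dual k C).obj (op M.unop.obj) ≅ (linearCoyoneda k C).obj (op W.unop) :=
    (IsFinPresLeft k C).ι.mapIso
      ((dualRestrict k C h).objObjPreimageIso (standardProjectiveLeft k W.unop))
  have hM : FinPres M.unop.obj := (isFinPresRight_iff _).1 M.unop.property
  have hMfin := hM.finite_obj (finite_hom_op hfin.finite_hom)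
  obtain ⟨B, A, f, b, hb⟩ := hM
  let θ : ∀ Z : Cᵒᵖ, (Z ⟶ W) →ₗ[k] Module.Dual k (M.unop.obj.obj Z) := fun Z =>
    { toFun := fun g => e.inv.app Z.unop g.unop
      map_add' := fun x y => map_add (e.inv.app Z.unop).hom x.unop y.unop
      map_smul' := fun c x => map_smul (e.inv.app Z.unop).hom c x.unop }
  have hθ : ∀ {Y Z : Cᵒᵖ} (x : Y ⟶ Z) (g : Z ⟶ W) (m : M.unop.obj.obj Y),
      θ Y (x ≫ g) m = θ Z g (M.unop.obj.map x m) := fun x g m =>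
    LinearMap.congr_fun (app_map e.inv x.unop (show W.unop ⟶ _ from g.unop)) m
  have θ_surj : ∀ Z, Function.Surjective (θ Z) := by
    intro Z φ
    obtain ⟨g, hg⟩ := (epi_iff_app_surjective e.inv).1 inferInstance Z.unop φ
    exact ⟨Quiver.Hom.op g, hg⟩
  have θ_inj : ∀ Z, Function.Injective (θ Z) := by
    intro Z x y hxy
    exact Quiver.Hom.unop_inj ((mono_iff_app_injective e.inv).1 inferInstance Z.unop hxy)
  refine ⟨B, A, f, (Module.Dual.eval k _ b).comp (θ B), ?_, ?_⟩
  · intro Z φ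
    have := hMfin Z
    let θe := LinearEquiv.ofBijective (θ Z) ⟨θ_inj Z, θ_surj Z⟩
    let m := (Module.evalEquiv k (M.unop.obj.obj Z)).symm (φ.comp θe.symm.toLinearMap)
    have hm : ∀ g, θ Z g m = φ g := by
      intro g
      refine (Module.apply_evalEquiv_symm_apply k _ _ _).trans ?_
      exact congrArg φ (θe.symm_apply_apply g)
    obtain ⟨x, hx⟩ := hb.surj m
    refine ⟨x, fun g => ?_⟩
    rw [← hm, ← hx]
    exact (hθ x g b).symm
  · intro Z x
    rw [← hb.map_eq_zero_iff]
    constructor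
    · intro hx
      refine (Module.forall_dual_apply_eq_zero_iff k _).1 fun φ => ?_
      obtain ⟨g, rfl⟩ := θ_surj Z φ
      exact (hθ x g b).symm.trans (hx g)
    · intro hx g
      refine (hθ x g b).trans ?_
      rw [hx, map_zero]

end

/-! ### Recovering the duality from finitely presented duals -/

section Duality

variable {k : Type v} [Field k] {C : Type u} [Category.{v} C]

/-- The pointwise dual of left modules, the counterpart of `dual` for covariant functors. -/
@[simps]
def dualOfLeft (k : Type v) [Field k] (C : Type u) [Category.{v} C] :
    (C ⥤ ModuleCat.{v} k)ᵒᵖ ⥤ (Cᵒᵖ ⥤ ModuleCat.{v} k) where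
  obj M :=
    { obj := fun x => ModuleCat.of k (Module.Dual k (M.unop.obj x.unop))
      map := fun f => ModuleCat.ofHom (M.unop.map f.unop).hom.dualMap
      map_id := by intro x; ext; simp
      map_comp := by intro x y z f g; ext; simp }
  map {M N} α :=
    { app := fun x => ModuleCat.ofHom (α.unop.app x.unop).hom.dualMap
      naturality := by
        intro x y f
        refine ModuleCat.hom_ext
          (LinearMap.ext fun (φ : Module.Dual k (M.unop.obj x.unop)) => ?_)
        refine LinearMap.ext (M := N.unop.obj y.unop) fun m => ?_
        exact congrArg φ (app_map α.unop f.unop m).symm }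
  map_id := by intro M; ext; simp
  map_comp := by intro M N P f g; ext; simp

theorem exists_dualMap_eq {V W : Type*} [AddCommGroup V] [AddCommGroup W] [Module k V] [Module k W]
    (p : V →ₗ[k] W) (φ : Module.Dual k V)
    (h : ∀ v, p v = 0 → φ v = 0) : ∃ ψ : Module.Dual k W, p.dualMap ψ = φ := by
  have : φ ∈ LinearMap.range p.dualMap := by
    rw [LinearMap.range_dualMap_eq_dualAnnihilator_ker, Submodule.mem_dualAnnihilator]
    exact h
  exact this

theorem nonempty_iso_dual_dualOfLeft (N : C ⥤ ModuleCat.{v} k) (h : ∀ Z, Module.Finite k (N.obj Z)) :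
    Nonempty ((dual k C).obj (op ((dualOfLeft k C).obj (op N))) ≅ N) := by
  refine ⟨(NatIso.ofComponents
    (fun Z => (Module.evalEquiv k (N.obj Z)).toModuleIso) ?_).symm⟩
  intro Y Z f
  rfl

theorem dual_map_injective {M N : (Cᵒᵖ ⥤ ModuleCat.{v} k)ᵒᵖ} {α β : M ⟶ N}
    (h : (dual k C).map α = (dual k C).map β) : α = β := by
  apply Quiver.Hom.unop_inj
  ext j n
  rw [← sub_eq_zero]
  refine (Module.forall_dual_apply_eq_zero_iff k _).1 fun φ => ?_
  rw [map_sub, sub_eq_zero]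
  exact DFunLike.congr_fun (F := Module.Dual k (N.unop.obj j))
    (congrArg (fun t => (t.app j.unop).hom φ) h) n

theorem exists_dual_map_eq {M N : (Cᵒᵖ ⥤ ModuleCat.{v} k)ᵒᵖ}
    (hM : ∀ Z, Module.Finite k (M.unop.obj Z)) (γ : (dual k C).obj M ⟶ (dual k C).obj N) :
    ∃ α : M ⟶ N, (dual k C).map α = γ := by
  let γ' : ∀ Z : Cᵒᵖ, Module.Dual k (M.unop.obj Z) →ₗ[k] Module.Dual k (N.unop.obj Z) :=
    fun Z => (γ.app Z.unop).hom
  -- The transpose of `γ` lands in the double dual of `M`, which is `M` by finite dimensionality.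
  let a : ∀ Z : Cᵒᵖ, N.unop.obj Z →ₗ[k] M.unop.obj Z := fun Z =>
    (Module.evalEquiv k (M.unop.obj Z)).symm.toLinearMap ∘ₗ (γ' Z).flip
  have ha : ∀ (Z : Cᵒᵖ) (n : N.unop.obj Z) (φ : Module.Dual k (M.unop.obj Z)),
      φ (a Z n) = γ' Z φ n := fun Z n φ => Module.apply_evalEquiv_symm_apply k _ φ _
  let α : N.unop ⟶ M.unop :=
    { app := fun Z => ModuleCat.ofHom (a Z)
      naturality := by
        intro Y Z f
        ext n
        rw [← sub_eq_zero]
        refine (Module.forall_dual_apply_eq_zero_iff k _).1 fun φ => ?_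
        rw [map_sub, sub_eq_zero]
        refine (ha Z (N.unop.map f n) φ).trans ?_
        refine Eq.trans ?_ (ha Y n (φ.comp (M.unop.map f).hom)).symm
        exact (DFunLike.congr_fun (F := Module.Dual k (N.unop.obj Y))
          (app_map γ f.unop φ) n).symm }
  refine ⟨α.op, ?_⟩
  ext j φ
  exact LinearMap.ext fun n => ha (op j) n φ

variable [Preadditive C] [Linear k C]

/-- Dualizing a presentation of `M` exhibits its dual as the kernel of a map between duals of
standard projectives. -/
theorem finPres_dual (hC : FinPresDualHoms k C) (hw : HasWeakPushouts C)
    {M : Cᵒᵖ ⥤ ModuleCat.{v} k} (hM : FinPres M) : FinPres ((dual k C).obj (op M)) := by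
  rw [finPresDualHoms_iff] at hC
  obtain ⟨A, B, f, p, hp, hc⟩ := (isFinPresRight_iff M).2 hM
  obtain ⟨hsurj, hex⟩ := (nonempty_isColimit_cokernelCofork_iff _ _ _).1 hc
  refine FinPres.kernel hw (hC B) (hC A) ((dual k C).map ((linearYoneda k C).map f).op)
    ((dual k C).map p.op) ?_ ?_ ?_
  · intro j
    exact LinearMap.dualMap_injective_of_surjective (hsurj (op j))
  · ext j φ
    refine LinearMap.ext fun x => ?_
    exact (congrArg (show Module.Dual k (M.obj (op j)) from φ)
      (congrArg (fun t => (t.app (op j)).hom x) hp)).trans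
        (map_zero (show Module.Dual k (M.obj (op j)) from φ))
  · intro j φ hφ
    let φ' : Module.Dual k (((linearYoneda k C).obj B).obj (op j)) := φ
    refine exists_dualMap_eq (p.app (op j)).hom φ' fun x hx => ?_
    obtain ⟨y, hy⟩ := hex (op j) x hx
    exact (congrArg φ' hy.symm).trans
      (DFunLike.congr_fun (F := Module.Dual k (((linearYoneda k C).obj A).obj (op j))) hφ y)

theorem finPres_dualOfLeft (hC : FinPresDualHoms k Cᵒᵖ) (hw : HasWeakPushouts Cᵒᵖ)
    {M : C ⥤ ModuleCat.{v} k} (hM : FinPres M) : FinPres ((dualOfLeft k C).obj (op M)) := by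
  have hP : ∀ W : C, FinPres ((dualOfLeft k C).obj (op ((linearCoyoneda k C).obj (op W)))) := by
    intro W
    obtain ⟨B, A, f, β, h₁, h₂⟩ := hC (op W)
    let β' : (W ⟶ B.unop) →ₗ[k] k :=
      { toFun := fun g => β g.op
        map_add' := fun x y => map_add β x.op y.op
        map_smul' := fun c x => map_smul β c x.op }
    refine ⟨B, A, f, β', ⟨?_, ?_, ?_, ?_⟩⟩
    · intro Z x y
      refine LinearMap.ext fun g : W ⟶ Z.unop => ?_
      exact (congrArg β' (Preadditive.comp_add _ _ _ g x.unop y.unop)).trans (map_add β' _ _)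
    · intro Z c x
      refine LinearMap.ext fun g : W ⟶ Z.unop => ?_
      exact (congrArg β' (Linear.comp_smul _ _ _ g c x.unop)).trans (map_smul β' _ _)
    · intro Z φ
      let φ' : (Z ⟶ op W) →ₗ[k] k :=
        { toFun := fun g => (show Module.Dual k (W ⟶ Z.unop) from φ) g.unop
          map_add' := fun x y => map_add (show Module.Dual k (W ⟶ Z.unop) from φ) x.unop y.unop
          map_smul' := fun c x => map_smul (show Module.Dual k (W ⟶ Z.unop) from φ) c x.unop }
      obtain ⟨x, hx⟩ := h₁ φ'
      exact ⟨x, LinearMap.ext fun g : W ⟶ Z.unop => (hx g.op).symm⟩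
    · intro Z x
      rw [← h₂]
      constructor
      · intro h g
        exact DFunLike.congr_fun (F := Module.Dual k (W ⟶ Z.unop)) h g.unop
      · intro h
        exact LinearMap.ext fun g : W ⟶ Z.unop => h g.op
  obtain ⟨A, B, f, p, hp, hc⟩ := (isFinPresLeft_iff M).2 hM
  obtain ⟨hsurj, hex⟩ := (nonempty_isColimit_cokernelCofork_iff _ _ _).1 hc
  refine FinPres.kernel hw (hP A) (hP B) ((dualOfLeft k C).map ((linearCoyoneda k C).map f.op).op)
    ((dualOfLeft k C).map p.op) ?_ ?_ ?_
  · intro j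
    exact LinearMap.dualMap_injective_of_surjective (hsurj j.unop)
  · ext j φ
    refine LinearMap.ext fun x => ?_
    exact (congrArg (show Module.Dual k (M.obj j.unop) from φ)
      (congrArg (fun t => (t.app j.unop).hom x) hp)).trans
        (map_zero (show Module.Dual k (M.obj j.unop) from φ))
  · intro j φ hφ
    let φ' : Module.Dual k (((linearCoyoneda k C).obj (op A)).obj j.unop) := φ
    refine exists_dualMap_eq (p.app j.unop).hom φ' fun x hx => ?_
    obtain ⟨y, hy⟩ := hex j.unop x hx
    exact (congrArg φ' hy.symm).trans
      (DFunLike.congr_fun (F := Module.Dual k (((linearCoyoneda k C).obj (op B)).obj j.unop)) hφ y)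

theorem isDualizing_of_finPresDualHoms (hfin : IsFiniteVariety k C) (h₁ : FinPresDualHoms k C)
    (h₂ : FinPresDualHoms k Cᵒᵖ) (hw₁ : HasWeakPushouts C) (hw₂ : HasWeakPushouts Cᵒᵖ) :
    IsDualizing k C := by
  have h : ∀ M, IsFinPresRight k C M → IsFinPresLeft k C ((dual k C).obj (op M)) := fun M hM =>
    (isFinPresLeft_iff _).2 (finPres_dual h₁ hw₁ ((isFinPresRight_iff M).1 hM))
  refine ⟨hfin, h, ⟨⟨?_⟩, ⟨?_⟩, ⟨?_⟩⟩⟩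
  · intro M N α β hαβ
    apply Quiver.Hom.unop_inj
    ext1
    exact Quiver.Hom.op_inj (dual_map_injective (congrArg (fun t => t.hom) hαβ))
  · intro M N γ
    obtain ⟨α, hα⟩ := exists_dual_map_eq (k := k) (M := op M.unop.obj) (N := op N.unop.obj)
      (((isFinPresRight_iff _).1 M.unop.property).finite_obj (finite_hom_op hfin.finite_hom)) γ.hom
    refine ⟨Quiver.Hom.op (ObjectProperty.homMk α.unop), ?_⟩
    ext1
    exact hα
  · intro N
    have hN := (isFinPresLeft_iff _).1 N.property
    obtain ⟨e⟩ := nonempty_iso_dual_dualOfLeft N.obj (hN.finite_obj hfin.finite_hom)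
    exact ⟨op ⟨(dualOfLeft k C).obj (op N.obj),
      (isFinPresRight_iff _).2 (finPres_dualOfLeft h₂ hw₂ hN)⟩,
      ⟨ObjectProperty.isoMk _ e⟩⟩

end Duality

/-! ### Transfer to reflective full subcategories -/

section Transfer

variable {k : Type v} [Field k] {C : Type u} [Category.{v} C] {D : Type u'} [Category.{v} D]

theorem HasWeakPushouts.of_isRightAdjoint (hC : HasWeakPushouts C) (i : D ⥤ C) [i.Full]
    [i.Faithful] [i.IsRightAdjoint] : HasWeakPushouts D := by
  let adj := Adjunction.ofIsRightAdjoint i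
  intro X Y Z f g
  obtain ⟨P, p, q, hpq, hu⟩ := hC (i.map f) (i.map g)
  have hp := i.map_preimage (p ≫ adj.unit.app P)
  have hq := i.map_preimage (q ≫ adj.unit.app P)
  refine ⟨i.leftAdjoint.obj P, i.preimage (p ≫ adj.unit.app P), i.preimage (q ≫ adj.unit.app P),
    ?_, ?_⟩
  · apply i.map_injective
    rw [i.map_comp, i.map_comp, hp, hq, reassoc_of% hpq]
  · intro T s t hst
    obtain ⟨r, hr₁, hr₂⟩ := hu (i.map s) (i.map t) (by rw [← i.map_comp, hst, i.map_comp])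
    have hr : adj.unit.app P ≫ i.map ((adj.homEquiv _ _).symm r) = r :=
      (adj.homEquiv_unit _ _ _).symm.trans ((adj.homEquiv _ _).apply_symm_apply r)
    refine ⟨(adj.homEquiv _ _).symm r, ?_, ?_⟩
    · apply i.map_injective
      rw [i.map_comp, hp, Category.assoc, hr, hr₁]
    · apply i.map_injective
      rw [i.map_comp, hq, Category.assoc, hr, hr₂]

variable [Preadditive C] [Linear k C] [Preadditive D] [Linear k D]

/-- Restricting a functor on `C` to `D` turns the representable of `B` into that of its reflection,
so the left adjoint applied to a presentation in `C` gives one in `D`. -/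
theorem FinPresDualHoms.of_isRightAdjoint (hC : FinPresDualHoms k C) (i : D ⥤ C) [i.Full]
    [i.Faithful] [i.Additive] [i.Linear k] [i.IsRightAdjoint] : FinPresDualHoms k D := by
  let adj := Adjunction.ofIsRightAdjoint i
  have hadj : ∀ {P : C} {T : D} (r : P ⟶ i.obj T),
      adj.unit.app P ≫ i.map ((adj.homEquiv _ _).symm r) = r := fun r =>
    (adj.homEquiv_unit _ _ _).symm.trans ((adj.homEquiv _ _).apply_symm_apply r)
  intro W
  obtain ⟨B, A, f, β, h₁, h₂⟩ := hC (i.obj W)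
  refine ⟨i.leftAdjoint.obj B, i.leftAdjoint.obj A, i.leftAdjoint.map f,
    β.comp ((Linear.leftComp k _ (adj.unit.app B)).comp (i.mapLinearMap k)), ?_, ?_⟩
  · intro Z φ
    let φ' : (i.obj Z ⟶ i.obj W) →ₗ[k] k :=
      { toFun := fun g => φ (i.preimage g)
        map_add' := fun x y => by
          rw [← map_add φ]
          congr 1
          exact i.map_injective (by simp)
        map_smul' := fun c x => by
          rw [← map_smul φ]
          congr 1
          exact i.map_injective (by simp) }
    obtain ⟨x, hx⟩ := h₁ φ'
    refine ⟨(adj.homEquiv _ _).symm x, fun g => ?_⟩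
    have : φ g = φ' (i.map g) := congrArg φ (i.preimage_map g).symm
    rw [this, hx]
    change _ = β (adj.unit.app B ≫ i.map ((adj.homEquiv _ _).symm x ≫ g))
    rw [i.map_comp, ← Category.assoc, hadj]
  · intro Z x
    have key : (∀ g : Z ⟶ W, β (adj.unit.app B ≫ i.map (x ≫ g)) = 0) ↔
        ∀ g : i.obj Z ⟶ i.obj W, β ((adj.unit.app B ≫ i.map x) ≫ g) = 0 := by
      constructor
      · intro h g
        have := h (i.preimage g)
        rwa [i.map_comp, i.map_preimage, ← Category.assoc] at this
      · intro h g
        rw [i.map_comp, ← Category.assoc]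
        exact h _
    refine key.trans ((h₂ _).trans ?_)
    have hf : adj.unit.app B ≫ i.map (i.leftAdjoint.map f) = f ≫ adj.unit.app A :=
      (adj.unit.naturality f).symm
    constructor
    · rintro ⟨y, hy⟩
      refine ⟨(adj.homEquiv _ _).symm y, (adj.homEquiv _ _).injective ?_⟩
      rw [adj.homEquiv_unit, adj.homEquiv_unit, hy, i.map_comp, reassoc_of% hf, hadj]
    · rintro ⟨y, rfl⟩
      exact ⟨adj.unit.app A ≫ i.map y, by rw [i.map_comp, reassoc_of% hf]⟩

theorem IsRickart.of_fullyFaithful (hC : IsRickart C) (i : D ⥤ C) [i.Full] [i.Faithful]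
    [i.Additive] : IsRickart D := by
  intro A B f
  obtain ⟨e, he, hu⟩ := hC (i.map f)
  refine ⟨i.preimage e, i.map_injective (by simp [he]), fun Z x hx => i.map_injective ?_⟩
  have := hu (i.map x) (by rw [← i.map_comp, hx, i.map_zero])
  simpa using this

instance functorOp_linear (i : D ⥤ C) [i.Additive] [i.Linear k] : i.op.Linear k where
  map_smul f c := congrArg Quiver.Hom.op (Functor.Linear.map_smul (F := i) f.unop c)

end Transfer

/-! ### Bricks and decompositions into bricks -/

section Bricks

variable {C : Type u} [Category.{v} C] [Preadditive C]

/-- `X` is a brick: a nonzero object all of whose nonzero endomorphisms are invertible. -/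
def IsBrick (X : C) : Prop := 𝟙 X ≠ 0 ∧ ∀ e : X ⟶ X, e ≠ 0 → IsIso e

/-- Morphisms with zero composition at a brick are zero. -/
def NoZeroDivisorsAtBricks (C : Type u) [Category.{v} C] [Preadditive C] : Prop :=
  ∀ ⦃X Y Z : C⦄, IsBrick Y → ∀ (f : X ⟶ Y) (g : Y ⟶ Z), f ≠ 0 → g ≠ 0 → f ≫ g ≠ 0

/-- `A` is a finite direct sum of bricks. -/
def HasBrickDecomposition (A : C) : Prop :=
  ∃ (J : Type) (_ : Fintype J) (B : J → C) (i : ∀ j, B j ⟶ A) (p : ∀ j, A ⟶ B j),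
    (∀ j, IsBrick (B j)) ∧ (∀ j, i j ≫ p j = 𝟙 _) ∧ (∀ j l, j ≠ l → i j ≫ p l = 0) ∧
      ∑ j, p j ≫ i j = 𝟙 A

theorem IsBrick.eq_id {X : C} (hX : IsBrick X) {e : X ⟶ X} (he : e ≫ e = e) (h0 : e ≠ 0) :
    e = 𝟙 X := by
  have := hX.2 e h0
  rw [← cancel_epi e, he, Category.comp_id]

theorem IsBrick.isIso_of_comp_eq_id {X Y : C} (hX : IsBrick X) (hY : IsBrick Y) {f : X ⟶ Y}
    {g : Y ⟶ X} (h : f ≫ g = 𝟙 X) : IsIso f := by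
  refine ⟨g, h, hY.eq_id ?_ ?_⟩
  · rw [Category.assoc, reassoc_of% h]
  · intro h0
    apply hX.1
    calc 𝟙 X = (f ≫ g) ≫ f ≫ g := by rw [h, Category.comp_id]
      _ = f ≫ (g ≫ f) ≫ g := by simp
      _ = 0 := by rw [h0]; simp

theorem IsBrick.isIso_of_isSplitMono {X Y : C} (hX : IsBrick X) (hY : IsBrick Y) {f : X ⟶ Y}
    (h : IsSplitMono f) : IsIso f :=
  hX.isIso_of_comp_eq_id hY (IsSplitMono.id f)

theorem IsBrick.isIso_of_isSplitEpi {X Y : C} (hX : IsBrick X) (hY : IsBrick Y) {f : X ⟶ Y}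
    (h : IsSplitEpi f) : IsIso f := by
  have : IsIso (section_ f) := hY.isIso_of_comp_eq_id hX (IsSplitEpi.id f)
  exact ⟨section_ f, by rw [← cancel_epi (section_ f)]; simp, IsSplitEpi.id f⟩

theorem IsBrick.isIso_of_comp_ne_zero {X Y : C} (hX : IsBrick X) (hY : IsBrick Y) {f : X ⟶ Y}
    {g : Y ⟶ X} (h : f ≫ g ≠ 0) : IsIso f := by
  have := hX.2 _ h
  exact hX.isIso_of_comp_eq_id hY (g := g ≫ inv (f ≫ g)) (by
    rw [← Category.assoc, IsIso.hom_inv_id])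

theorem IsBrick.exists_retract_of_sum {Z : C} (hZ : IsBrick Z) {J : Type} [Fintype J]
    {A : C} {B : J → C} (i : ∀ j, B j ⟶ A) (p : ∀ j, A ⟶ B j) (h : ∑ j, p j ≫ i j = 𝟙 A)
    (r : Retract Z A) : ∃ j, Nonempty (Retract Z (B j)) := by
  have h1 : ∑ j, r.i ≫ p j ≫ i j ≫ r.r = 𝟙 Z := by
    have : r.i ≫ (∑ j, p j ≫ i j) ≫ r.r = 𝟙 Z := by rw [h, Category.id_comp, r.retract]
    rw [← this, Preadditive.sum_comp, Preadditive.comp_sum]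
    simp
  obtain ⟨j, -, hj⟩ := Finset.exists_ne_zero_of_sum_ne_zero (by rw [h1]; exact hZ.1)
  have := hZ.2 _ hj
  exact ⟨j, ⟨⟨r.i ≫ p j, i j ≫ r.r ≫ inv (r.i ≫ p j ≫ i j ≫ r.r), by
    have := IsIso.hom_inv_id (r.i ≫ p j ≫ i j ≫ r.r)
    simp only [Category.assoc] at this ⊢
    exact this⟩⟩⟩

theorem isBrick_op_iff {X : C} : IsBrick (op X) ↔ IsBrick X := by
  constructor
  · rintro ⟨h₁, h₂⟩
    refine ⟨fun h => h₁ (congrArg Quiver.Hom.op h), fun e he => ?_⟩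
    have := h₂ e.op fun h => he (congrArg Quiver.Hom.unop h)
    exact isIso_of_op e
  · rintro ⟨h₁, h₂⟩
    refine ⟨fun h => h₁ (congrArg Quiver.Hom.unop h), fun e he => ?_⟩
    have := h₂ e.unop fun h => he (congrArg Quiver.Hom.op h)
    exact (isIso_unop_iff e).1 this

theorem NoZeroDivisorsAtBricks.op (h : NoZeroDivisorsAtBricks C) : NoZeroDivisorsAtBricks Cᵒᵖ := by
  intro X Y Z hY f g hf hg h0
  exact h (isBrick_op_iff.1 hY) g.unop f.unop (fun h => hg (congrArg Quiver.Hom.op h))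
    (fun h => hf (congrArg Quiver.Hom.op h)) (congrArg Quiver.Hom.unop h0)

theorem HasBrickDecomposition.op {A : C} (h : HasBrickDecomposition A) :
    HasBrickDecomposition (op A) := by
  obtain ⟨J, _, B, i, p, hB, h₁, h₂, h₃⟩ := h
  refine ⟨J, inferInstance, fun j => Opposite.op (B j), fun j => (p j).op, fun j => (i j).op,
    fun j => isBrick_op_iff.2 (hB j), fun j => congrArg Quiver.Hom.op (h₁ j),
    fun j l hjl => congrArg Quiver.Hom.op (h₂ l j hjl.symm), ?_⟩
  apply Quiver.Hom.unop_inj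
  rw [unop_sum]
  exact h₃

/-- The idempotent attached to a nonzero `g` is nonzero, hence the identity of the brick, and so `g`
is a monomorphism. -/
theorem IsRickart.noZeroDivisorsAtBricks (hC : IsRickart C) : NoZeroDivisorsAtBricks C := by
  intro X Y Z hY f g hf hg h0
  obtain ⟨e, he, hu⟩ := hC g
  have hee : e ≫ e = e := by
    have := hu (𝟙 Y - e) (by simp [he])
    rw [Preadditive.sub_comp, Category.id_comp, sub_eq_zero] at this
    exact this.symm
  have h1 : e = 𝟙 Y := hY.eq_id hee fun h => hg (by rw [← he, h, zero_comp])
  have := hu f h0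
  rw [h1, Category.comp_id] at this
  exact hf this

section

variable [HasBinaryBiproducts C]

theorem IsBrick.indecomposable {X : C} (hX : IsBrick X) : Indecomposable X := by
  refine ⟨fun h => hX.1 (h.eq_of_src _ _), fun Y Z e => ?_⟩
  by_cases h0 : e.hom ≫ biprod.fst ≫ biprod.inl ≫ e.inv = 0
  · left
    rw [IsZero.iff_id_eq_zero]
    calc 𝟙 Y = biprod.inl ≫ e.inv ≫ (e.hom ≫ biprod.fst ≫ biprod.inl ≫ e.inv) ≫ e.hom ≫
          biprod.fst := by simp
      _ = 0 := by rw [h0]; simp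
  · right
    have h1 := hX.eq_id (by simp) h0
    rw [IsZero.iff_id_eq_zero]
    calc 𝟙 Z = biprod.inr ≫ e.inv ≫ 𝟙 X ≫ e.hom ≫ biprod.snd := by simp
      _ = 0 := by rw [← h1]; simp

theorem Indecomposable.idempotent_eq [IsIdempotentComplete C] {X : C} (hX : Indecomposable X)
    {e : X ⟶ X} (he : e ≫ e = e) : e = 0 ∨ e = 𝟙 X := by
  obtain ⟨Y, i, r, hir, hri⟩ := IsIdempotentComplete.idempotents_split X e he
  obtain ⟨Z, j, s, hjs, hsj⟩ := IsIdempotentComplete.idempotents_split X (𝟙 X - e) (by simp [he])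
  have hi : i ≫ e = i := by rw [← hri, reassoc_of% hir]
  have hj : j ≫ e = 0 := by
    have : j ≫ (𝟙 X - e) = j := by rw [← hsj, reassoc_of% hjs]
    simpa using this
  have his : i ≫ s = 0 := by
    have : i ≫ s ≫ j ≫ s = 0 := by rw [reassoc_of% hsj]; simp [reassoc_of% hi]
    simpa [hjs] using this
  have hjr : j ≫ r = 0 := by
    have : j ≫ r ≫ i ≫ r = 0 := by rw [reassoc_of% hri, reassoc_of% hj]; simp
    simpa [hir] using this
  let E : X ≅ Y ⊞ Z :=
    { hom := biprod.lift r s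
      inv := biprod.desc i j
      hom_inv_id := by rw [biprod.lift_desc, hri, hsj]; abel
      inv_hom_id := by ext <;> simp [hir, hjs, his, hjr] }
  rcases hX.2 Y Z E with h | h
  · left
    rw [← hri, h.eq_of_tgt r 0, zero_comp]
  · right
    have : 𝟙 X - e = 0 := by rw [← hsj, h.eq_of_tgt s 0, zero_comp]
    exact (sub_eq_zero.1 this).symm

variable {k : Type v} [Field k] [Linear k C]

/-- The idempotent attached to `f` is the identity, so composing with `f` is injective on the
finite-dimensional endomorphism space, hence surjective. -/
theorem Indecomposable.isBrick [IsIdempotentComplete C] (hC : IsRickart C)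
    (hfin : ∀ A B : C, Module.Finite k (A ⟶ B)) {X : C} (hX : Indecomposable X) : IsBrick X := by
  refine ⟨fun h => hX.1 ((IsZero.iff_id_eq_zero X).2 h), fun f hf => ?_⟩
  obtain ⟨e, he, hu⟩ := hC f
  have hee : e ≫ e = e := by
    have := hu (𝟙 X - e) (by simp [he])
    rw [Preadditive.sub_comp, Category.id_comp, sub_eq_zero] at this
    exact this.symm
  have h1 : e = 𝟙 X := (Indecomposable.idempotent_eq hX hee).resolve_left fun h =>
    hf (by rw [← he, h, zero_comp])
  have hinj : ∀ x : X ⟶ X, x ≫ f = 0 → x = 0 := fun x hx => by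
    have := hu x hx
    rwa [h1, Category.comp_id] at this
  have := hfin X X
  have inj : Function.Injective (Linear.rightComp k X f) :=
    (injective_iff_map_eq_zero _).2 hinj
  obtain ⟨g, hg⟩ := LinearMap.surjective_of_injective inj (𝟙 X)
  have hg : g ≫ f = 𝟙 X := hg
  refine ⟨g, ?_, hg⟩
  rw [← sub_eq_zero]
  apply hinj
  simp [hg]

/-- Induction on the dimension of the endomorphism space: for `A ≅ Y ⊞ Z` the spaces of `Y` and `Z`
embed jointly into that of `A`, and both are nonzero. -/
theorem hasBrickDecomposition_of_indecomposable_isBrick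
    (hfin : ∀ A B : C, Module.Finite k (A ⟶ B))
    (hC : ∀ X : C, Indecomposable X → IsBrick X) (A : C) : HasBrickDecomposition A := by
  induction hn : Module.finrank k (A ⟶ A) using Nat.strong_induction_on generalizing A with
  | _ n ih =>
  by_cases hA : IsZero A
  · exact ⟨Empty, inferInstance, Empty.elim, fun j => j.elim, fun j => j.elim, fun j => j.elim,
      fun j => j.elim, fun j => j.elim, hA.eq_of_src _ _⟩
  by_cases hI : Indecomposable A
  · refine ⟨Unit, inferInstance, fun _ => A, fun _ => 𝟙 A, fun _ => 𝟙 A, fun _ => hC A hI,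
      fun _ => by simp, fun j l h => (h (Subsingleton.elim _ _)).elim, by simp⟩
  have : ∃ Y Z : C, Nonempty (A ≅ Y ⊞ Z) ∧ ¬ IsZero Y ∧ ¬ IsZero Z := by
    by_contra! h
    refine hI ⟨hA, fun Y Z e => ?_⟩
    by_cases hY : IsZero Y
    · exact Or.inl hY
    · exact Or.inr (h Y Z ⟨e⟩ hY)
  obtain ⟨Y, Z, ⟨e⟩, hY, hZ⟩ := this
  have := hfin A A
  have := hfin Y Y
  have := hfin Z Z
  let T : ((Y ⟶ Y) × (Z ⟶ Z)) →ₗ[k] (A ⟶ A) :=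
    { toFun := fun x => e.hom ≫ (biprod.fst ≫ x.1 ≫ biprod.inl + biprod.snd ≫ x.2 ≫ biprod.inr) ≫
        e.inv
      map_add' := fun x y => by simp; abel
      map_smul' := fun c x => by simp [smul_add] }
  have hT : Function.Injective T := by
    refine (injective_iff_map_eq_zero T).2 fun x hx => ?_
    have hx : e.hom ≫ (biprod.fst ≫ x.1 ≫ biprod.inl + biprod.snd ≫ x.2 ≫ biprod.inr) ≫
        e.inv = 0 := hx
    rw [Preadditive.IsIso.comp_left_eq_zero, Preadditive.IsIso.comp_right_eq_zero] at hx
    ext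
    · simpa using congrArg (fun t => biprod.inl ≫ t ≫ biprod.fst) hx
    · simpa using congrArg (fun t => biprod.inr ≫ t ≫ biprod.snd) hx
  have hle := LinearMap.finrank_le_finrank_of_injective hT
  rw [Module.finrank_prod] at hle
  have pos : ∀ {W : C}, Module.Finite k (W ⟶ W) → ¬ IsZero W → 0 < Module.finrank k (W ⟶ W) := by
    intro W _ hW
    have : Nontrivial (W ⟶ W) := ⟨𝟙 W, 0, fun h => hW ((IsZero.iff_id_eq_zero W).2 h)⟩
    exact Module.finrank_pos
  have hYp := pos inferInstance hY
  have hZp := pos inferInstance hZ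
  obtain ⟨J₁, _, B₁, i₁, p₁, hB₁, h₁, h₁', h₁''⟩ := ih _ (by omega) Y rfl
  obtain ⟨J₂, _, B₂, i₂, p₂, hB₂, h₂, h₂', h₂''⟩ := ih _ (by omega) Z rfl
  refine ⟨J₁ ⊕ J₂, inferInstance, Sum.elim B₁ B₂,
    Sum.rec (fun j => i₁ j ≫ biprod.inl ≫ e.inv) (fun j => i₂ j ≫ biprod.inr ≫ e.inv),
    Sum.rec (fun j => e.hom ≫ biprod.fst ≫ p₁ j) (fun j => e.hom ≫ biprod.snd ≫ p₂ j),
    ?_, ?_, ?_, ?_⟩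
  · rintro (j | j)
    exacts [hB₁ j, hB₂ j]
  · rintro (j | j)
    · simpa using h₁ j
    · simpa using h₂ j
  · rintro (j | j) (l | l) hjl
    · change (i₁ j ≫ biprod.inl ≫ e.inv) ≫ e.hom ≫ biprod.fst ≫ p₁ l = 0
      simpa using h₁' j l (fun h => hjl (congrArg _ h))
    · change (i₁ j ≫ biprod.inl ≫ e.inv) ≫ e.hom ≫ biprod.snd ≫ p₂ l = 0
      simp
    · change (i₂ j ≫ biprod.inr ≫ e.inv) ≫ e.hom ≫ biprod.fst ≫ p₁ l = 0
      simp
    · change (i₂ j ≫ biprod.inr ≫ e.inv) ≫ e.hom ≫ biprod.snd ≫ p₂ l = 0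
      simpa using h₂' j l (fun h => hjl (congrArg _ h))
  · rw [Fintype.sum_sum_type]
    have e₁ : ∑ j, (e.hom ≫ biprod.fst ≫ p₁ j) ≫ i₁ j ≫ biprod.inl ≫ e.inv =
        e.hom ≫ biprod.fst ≫ biprod.inl ≫ e.inv := by
      calc _ = e.hom ≫ biprod.fst ≫ (∑ j, p₁ j ≫ i₁ j) ≫ biprod.inl ≫ e.inv := by
            simp only [Preadditive.sum_comp, Preadditive.comp_sum, Category.assoc]
        _ = _ := by rw [h₁'', Category.id_comp]
    have e₂ : ∑ j, (e.hom ≫ biprod.snd ≫ p₂ j) ≫ i₂ j ≫ biprod.inr ≫ e.inv =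
        e.hom ≫ biprod.snd ≫ biprod.inr ≫ e.inv := by
      calc _ = e.hom ≫ biprod.snd ≫ (∑ j, p₂ j ≫ i₂ j) ≫ biprod.inr ≫ e.inv := by
            simp only [Preadditive.sum_comp, Preadditive.comp_sum, Category.assoc]
        _ = _ := by rw [h₂'', Category.id_comp]
    refine (congrArg₂ (· + ·) e₁ e₂).trans ?_
    calc _ = e.hom ≫ (biprod.fst ≫ biprod.inl + biprod.snd ≫ biprod.inr) ≫ e.inv := by
          simp only [Preadditive.add_comp, Preadditive.comp_add, Category.assoc]
      _ = 𝟙 A := by rw [biprod.total]; simp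

end

end Bricks

/-! ### Threads of bricks and the reflection -/

section Threads

variable {C : Type u} [Category.{v} C]

theorem isMinimalAlmostSplitFrom_op_iff {X N : C} {f : N ⟶ X} :
    IsMinimalAlmostSplitFrom f.op ↔ IsMinimalAlmostSplitTo f := by
  have hs : ∀ {A B : C} (g : A ⟶ B), IsSplitMono g.op ↔ IsSplitEpi g := by
    intro A B g
    constructor
    · rintro ⟨⟨s, hs⟩⟩
      exact ⟨⟨⟨s.unop, congrArg Quiver.Hom.unop hs⟩⟩⟩
    · rintro ⟨⟨s, hs⟩⟩
      exact ⟨⟨⟨s.op, congrArg Quiver.Hom.op hs⟩⟩⟩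
  constructor
  · rintro ⟨h₁, h₂, h₃⟩
    refine ⟨fun h => h₁ ((hs f).2 h), fun B g hg => ?_, fun h hh => ?_⟩
    · obtain ⟨t, ht⟩ := h₂ g.op fun h => hg ((hs g).1 h)
      exact ⟨t.unop, congrArg Quiver.Hom.unop ht⟩
    · have := h₃ h.op (congrArg Quiver.Hom.op hh)
      exact isIso_of_op h
  · rintro ⟨h₁, h₂, h₃⟩
    refine ⟨fun h => h₁ ((hs f).1 h), fun B g hg => ?_, fun h hh => ?_⟩
    · obtain ⟨t, ht⟩ := h₂ g.unop fun h => hg ((hs g.unop).2 h)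
      exact ⟨t.op, congrArg Quiver.Hom.op ht⟩
    · have := h₃ h.unop (congrArg Quiver.Hom.unop hh)
      exact (isIso_unop_iff h).1 this

theorem isMinimalAlmostSplitTo_op_iff {X M : C} {f : X ⟶ M} :
    IsMinimalAlmostSplitTo f.op ↔ IsMinimalAlmostSplitFrom f := by
  have hs : ∀ {A B : C} (g : A ⟶ B), IsSplitEpi g.op ↔ IsSplitMono g := by
    intro A B g
    constructor
    · rintro ⟨⟨s, hs⟩⟩
      exact ⟨⟨⟨s.unop, congrArg Quiver.Hom.unop hs⟩⟩⟩
    · rintro ⟨⟨s, hs⟩⟩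
      exact ⟨⟨⟨s.op, congrArg Quiver.Hom.op hs⟩⟩⟩
  constructor
  · rintro ⟨h₁, h₂, h₃⟩
    refine ⟨fun h => h₁ ((hs f).2 h), fun B g hg => ?_, fun h hh => ?_⟩
    · obtain ⟨t, ht⟩ := h₂ g.op fun h => hg ((hs g).1 h)
      exact ⟨t.unop, congrArg Quiver.Hom.unop ht⟩
    · have := h₃ h.op (congrArg Quiver.Hom.op hh)
      exact isIso_of_op h
  · rintro ⟨h₁, h₂, h₃⟩
    refine ⟨fun h => h₁ ((hs f).1 h), fun B g hg => ?_, fun h hh => ?_⟩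
    · obtain ⟨t, ht⟩ := h₂ g.unop fun h => hg ((hs g.unop).2 h)
      exact ⟨t.op, congrArg Quiver.Hom.op ht⟩
    · have := h₃ h.unop (congrArg Quiver.Hom.unop hh)
      exact (isIso_unop_iff h).1 this

variable [Preadditive C]

/-- `Z` lies between `X` and `Y`. -/
def IsBetween (X Y Z : C) : Prop := (∃ f : X ⟶ Z, f ≠ 0) ∧ ∃ g : Z ⟶ Y, g ≠ 0

/-- A brick with a unique direct successor and a unique direct predecessor. -/
def IsThreadBrick (X : C) : Prop :=
  IsBrick X ∧
    (∃ (M : C) (f : X ⟶ M), IsBrick M ∧ IsMinimalAlmostSplitFrom f) ∧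
    (∃ (N : C) (g : N ⟶ X), IsBrick N ∧ IsMinimalAlmostSplitTo g)

/-- All bricks between the bricks `X` and `Y` are thread bricks. -/
def IsBrickThread (X Y : C) : Prop :=
  IsBrick X ∧ IsBrick Y ∧ ∀ Z : C, IsBrick Z → IsBetween X Y Z → IsThreadBrick Z

/-- A thread of bricks not properly contained in another one. -/
def IsMaximalBrickThread (X Y : C) : Prop :=
  IsBrickThread X Y ∧ ∀ X' Y' : C, IsBrickThread X' Y' →
    (∀ Z, IsBrick Z → IsBetween X Y Z → IsBetween X' Y' Z) →
      ∀ Z, IsBrick Z → IsBetween X' Y' Z → IsBetween X Y Z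

/-- The objects without brick summands between `X i` and `Y i`. -/
def avoids {I : Type w} (X Y : I → C) : ObjectProperty C := fun A =>
  ∀ (i : I) (Z : C), IsBrick Z → IsBetween (X i) (Y i) Z → IsEmpty (Retract Z A)

theorem IsMinimalAlmostSplitFrom.ne_zero {X M : C} {f : X ⟶ M} (hM : IsBrick M)
    (hf : IsMinimalAlmostSplitFrom f) : f ≠ 0 := by
  rintro rfl
  have := hf.2.2 0 (by simp)
  apply hM.1
  rw [← cancel_epi (0 : M ⟶ M)]
  simp

theorem IsMinimalAlmostSplitTo.ne_zero {X N : C} {f : N ⟶ X} (hN : IsBrick N)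
    (hf : IsMinimalAlmostSplitTo f) : f ≠ 0 := by
  rintro rfl
  have := hf.2.2 0 (by simp)
  apply hN.1
  rw [← cancel_mono (0 : N ⟶ N)]
  simp

theorem isBetween_op_iff {X Y Z : C} : IsBetween (op Y) (op X) (op Z) ↔ IsBetween X Y Z := by
  constructor
  · rintro ⟨⟨f, hf⟩, g, hg⟩
    exact ⟨⟨g.unop, fun h => hg (congrArg Quiver.Hom.op h)⟩, f.unop,
      fun h => hf (congrArg Quiver.Hom.op h)⟩
  · rintro ⟨⟨f, hf⟩, g, hg⟩
    exact ⟨⟨g.op, fun h => hg (congrArg Quiver.Hom.unop h)⟩, f.op,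
      fun h => hf (congrArg Quiver.Hom.unop h)⟩

theorem isThreadBrick_op_iff {X : C} : IsThreadBrick (op X) ↔ IsThreadBrick X := by
  constructor
  · rintro ⟨h, ⟨M, f, hM, hf⟩, ⟨N, g, hN, hg⟩⟩
    exact ⟨isBrick_op_iff.1 h,
      ⟨N.unop, g.unop, isBrick_op_iff.1 hN, isMinimalAlmostSplitTo_op_iff.1 hg⟩,
      ⟨M.unop, f.unop, isBrick_op_iff.1 hM, isMinimalAlmostSplitFrom_op_iff.1 hf⟩⟩
  · rintro ⟨h, ⟨M, f, hM, hf⟩, ⟨N, g, hN, hg⟩⟩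
    exact ⟨isBrick_op_iff.2 h,
      ⟨op N, g.op, isBrick_op_iff.2 hN, isMinimalAlmostSplitFrom_op_iff.2 hg⟩,
      ⟨op M, f.op, isBrick_op_iff.2 hM, isMinimalAlmostSplitTo_op_iff.2 hf⟩⟩

theorem isBrickThread_op_iff {X Y : C} : IsBrickThread (op Y) (op X) ↔ IsBrickThread X Y := by
  constructor
  · rintro ⟨h₁, h₂, h₃⟩
    exact ⟨isBrick_op_iff.1 h₂, isBrick_op_iff.1 h₁, fun Z hZ hXY => isThreadBrick_op_iff.1
      (h₃ (op Z) (isBrick_op_iff.2 hZ) (isBetween_op_iff.2 hXY))⟩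
  · rintro ⟨h₁, h₂, h₃⟩
    exact ⟨isBrick_op_iff.2 h₂, isBrick_op_iff.2 h₁, fun Z hZ hXY => isThreadBrick_op_iff.2
      (h₃ Z.unop (isBrick_op_iff.1 hZ) (isBetween_op_iff.1 hXY))⟩

theorem IsMaximalBrickThread.op {X Y : C} (h : IsMaximalBrickThread X Y) :
    IsMaximalBrickThread (op Y) (op X) := by
  refine ⟨isBrickThread_op_iff.2 h.1, fun Y' X' ht hle Z hZ hb => ?_⟩
  refine isBetween_op_iff.2 (h.2 X'.unop Y'.unop (isBrickThread_op_iff.1 ht) (fun W hW hWb => ?_)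
    Z.unop (isBrick_op_iff.1 hZ) (isBetween_op_iff.1 hb))
  exact isBetween_op_iff.1 (hle (Opposite.op W) (isBrick_op_iff.2 hW) (isBetween_op_iff.2 hWb))

theorem avoids_op_iff {I : Type w} {X Y : I → C} {A : C} :
    avoids (fun i => op (Y i)) (fun i => op (X i)) (op A) ↔ avoids X Y A := by
  constructor
  · intro h i Z hZ hb
    refine ⟨fun r => (h i (op Z) (isBrick_op_iff.2 hZ) (isBetween_op_iff.2 hb)).false ?_⟩
    exact ⟨r.r.op, r.i.op, congrArg Quiver.Hom.op r.retract⟩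
  · intro h i Z hZ hb
    refine ⟨fun r => (h i Z.unop (isBrick_op_iff.1 hZ) (isBetween_op_iff.1 hb)).false ?_⟩
    exact ⟨r.r.unop, r.i.unop, congrArg Quiver.Hom.unop r.retract⟩

theorem IsBetween.of_iso {X Y Z Z' : C} (h : IsBetween X Y Z) (f : Z ⟶ Z') [IsIso f] :
    IsBetween X Y Z' := by
  obtain ⟨⟨a, ha⟩, b, hb⟩ := h
  exact ⟨⟨a ≫ f, by rwa [Ne, Preadditive.IsIso.comp_right_eq_zero]⟩,
    inv f ≫ b, by rwa [Ne, Preadditive.IsIso.comp_left_eq_zero]⟩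

theorem IsThreadBrick.of_iso {Z Z' : C} (h : IsThreadBrick Z) (e : Z ≅ Z') : IsThreadBrick Z' := by
  obtain ⟨⟨h1, h2⟩, ⟨M, f, hM, hf₁, hf₂, hf₃⟩, ⟨N, g, hN, hg₁, hg₂, hg₃⟩⟩ := h
  refine ⟨⟨fun h => h1 ?_, fun a ha => ?_⟩, ⟨M, e.inv ≫ f, hM, fun h => hf₁ ?_, fun B a ha => ?_,
    fun a ha => hf₃ a ?_⟩, ⟨N, g ≫ e.hom, hN, fun h => hg₁ ?_, fun B a ha => ?_,
    fun a ha => hg₃ a ?_⟩⟩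
  · rw [← e.hom_inv_id, ← Category.id_comp e.inv, h]
    simp
  · have := h2 (e.hom ≫ a ≫ e.inv) (by
      rwa [Ne, Preadditive.IsIso.comp_left_eq_zero, Preadditive.IsIso.comp_right_eq_zero])
    have h' : a = e.inv ≫ (e.hom ≫ a ≫ e.inv) ≫ e.hom := by simp
    rw [h']
    infer_instance
  · have : f = e.hom ≫ e.inv ≫ f := by simp
    rw [this]
    infer_instance
  · obtain ⟨t, ht⟩ := hf₂ (e.hom ≫ a) fun h => ha (by
      have : a = e.inv ≫ e.hom ≫ a := by simp
      rw [this]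
      infer_instance)
    exact ⟨t, by simp [ht]⟩
  · simpa using ha
  · have : g = (g ≫ e.hom) ≫ e.inv := by simp
    rw [this]
    infer_instance
  · obtain ⟨t, ht⟩ := hg₂ (a ≫ e.inv) fun h => ha (by
      have : a = (a ≫ e.inv) ≫ e.hom := by simp
      rw [this]
      infer_instance)
    exact ⟨t, by rw [reassoc_of% ht]; simp⟩
  · rw [← cancel_mono e.hom]
    simpa using ha

/-- A minimal right almost split map between bricks is left almost split if its source has a
unique direct successor. -/
theorem IsMinimalAlmostSplitTo.exists_comp_eq {N Z : C} {z : N ⟶ Z} (hz : IsMinimalAlmostSplitTo z)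
    (hZ : IsBrick Z) (hN : IsThreadBrick N) {B : C} (g : N ⟶ B) (hg : ¬ IsSplitMono g) :
    ∃ h, z ≫ h = g := by
  obtain ⟨M, n, hM, hn₁, hn₂, hn₃⟩ := hN.2.1
  have hz0 := hz.ne_zero hN.1
  obtain ⟨m, hm⟩ := hn₂ z fun h => hz.1 (by
    have := hN.1.isIso_of_isSplitMono hZ h
    infer_instance)
  obtain ⟨g', hg'⟩ := hn₂ g hg
  by_cases hms : IsSplitEpi m
  · have := hM.isIso_of_isSplitEpi hZ hms
    exact ⟨inv m ≫ g', by rw [← hm, ← hg']; simp⟩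
  -- Here `z` would equal `n ≫ m' ≫ z`. So `n ≫ m'` is a nonzero map from `N` to itself, forcing the
  -- almost split map `n` to be invertible.
  · obtain ⟨m', hm'⟩ := hz.2.1 m hms
    have h0 : n ≫ m' ≠ 0 := fun h0 => hz0 (by rw [← hm, ← hm', reassoc_of% h0, zero_comp])
    have := hN.1.isIso_of_comp_ne_zero hM h0
    exact (hn₁ inferInstance).elim

/-- A minimal left almost split map between bricks is right almost split if its target has a
unique direct predecessor. -/
theorem IsMinimalAlmostSplitFrom.exists_comp_eq {Y M : C} {y : Y ⟶ M}
    (hy : IsMinimalAlmostSplitFrom y) (hY : IsBrick Y) (hM : IsThreadBrick M) {B : C} (g : B ⟶ M)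
    (hg : ¬ IsSplitEpi g) : ∃ h, h ≫ y = g := by
  obtain ⟨h, hh⟩ := (isMinimalAlmostSplitTo_op_iff.2 hy).exists_comp_eq (isBrick_op_iff.2 hY)
    (isThreadBrick_op_iff.2 hM) g.op fun ⟨⟨s, hs⟩⟩ => hg
      ⟨⟨⟨s.unop, congrArg Quiver.Hom.unop hs⟩⟩⟩
  exact ⟨h.unop, congrArg Quiver.Hom.unop hh⟩

theorem IsBetween.comp {X Y A B Z : C} (hC : NoZeroDivisorsAtBricks C) (hA : IsBrick A)
    (hB : IsBrick B) (h : IsBetween A B Z) {f : X ⟶ A} (hf : f ≠ 0) {g : B ⟶ Y} (hg : g ≠ 0) :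
    IsBetween X Y Z := by
  obtain ⟨⟨a, ha⟩, b, hb⟩ := h
  exact ⟨⟨f ≫ a, hC hA f a hf ha⟩, b ≫ g, hC hB b g hb hg⟩

/-- The direct successor of the end of a nonzero maximal thread is not a thread brick. -/
theorem IsMaximalBrickThread.not_isThreadBrick (hC : NoZeroDivisorsAtBricks C) {X Y M : C}
    (h : IsMaximalBrickThread X Y) {a : X ⟶ Y} (ha : a ≠ 0) {y : Y ⟶ M}
    (hy : IsMinimalAlmostSplitFrom y) : ¬ IsThreadBrick M := by
  intro hM
  have hX := h.1.1
  have hY := h.1.2.1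
  have hy0 := hy.ne_zero hM.1
  -- If `M` were a thread brick, adding it would extend the thread: every non-split map to `M`
  -- factors through `y`, so the only brick gained is `M` up to isomorphism.
  have hT : IsBrickThread X M := by
    refine ⟨hX, hM.1, fun Z hZ hXM => ?_⟩
    obtain ⟨⟨f, hf⟩, g, hg⟩ := hXM
    by_cases hs : IsSplitEpi g
    · have := hZ.isIso_of_isSplitEpi hM.1 hs
      exact hM.of_iso (asIso g).symm
    · obtain ⟨t, rfl⟩ := hy.exists_comp_eq hY hM g hs
      exact h.1.2.2 Z hZ ⟨⟨f, hf⟩, t, fun h => hg (by rw [h, zero_comp])⟩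
  obtain ⟨-, w, hw⟩ := h.2 X M hT (fun Z _ ⟨hf, g, hg⟩ => ⟨hf, g ≫ y, hC hY g y hg hy0⟩) M hM.1
    ⟨⟨a ≫ y, hC hY a y ha hy0⟩, 𝟙 M, hM.1.1⟩
  have := hY.isIso_of_comp_ne_zero hM.1 (hC hM.1 y w hy0 hw)
  exact hy.1 inferInstance

variable {k : Type v} [Field k] [Linear k C]

/-- View `φ` as an element of the dual of `C(-, W)` at `A`. Its annihilator in `C(A, -)` is finitely
generated, by a weak pushout of a lift of `φ` with the relations of that dual. -/
theorem FinPresDualHoms.exists_generator (hI : FinPresDualHoms k C) (hw : HasWeakPushouts C)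
    {A W : C} (φ : (A ⟶ W) →ₗ[k] k) : ∃ (G : C) (x : A ⟶ G), (∀ g : G ⟶ W, φ (x ≫ g) = 0) ∧
      ∀ ⦃Z : C⦄ (y : A ⟶ Z), (∀ g : Z ⟶ W, φ (y ≫ g) = 0) → ∃ c, y = x ≫ c := by
  obtain ⟨B, A', f, β, h₁, h₂⟩ := hI W
  obtain ⟨x₀, hx₀⟩ := h₁ φ
  obtain ⟨P, p, q, hpq, hu⟩ := hw x₀ f
  refine ⟨P, p, fun g => ?_, fun Z y hy => ?_⟩
  · rw [hx₀, ← Category.assoc]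
    exact (h₂ (x₀ ≫ p)).2 ⟨q, hpq⟩ g
  · obtain ⟨t, ht⟩ := (h₂ (x₀ ≫ y)).1 fun g => by rw [Category.assoc, ← hx₀, hy]
    obtain ⟨r, hr, -⟩ := hu y t ht
    exact ⟨r, hr.symm⟩

/-- Morphisms out of a thread factor through its end. -/
theorem exists_eq_comp_of_not_isBetween (hC : NoZeroDivisorsAtBricks C)
    (hdec : ∀ A : C, HasBrickDecomposition A) (hI : FinPresDualHoms k C) (hw : HasWeakPushouts C)
    {A Y W : C} (hT : IsBrickThread A Y) (hW : IsBrick W) (hWb : ¬ IsBetween A Y W)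
    {h : A ⟶ Y} (h0 : h ≠ 0) (f : A ⟶ W) : ∃ g, f = h ≫ g := by
  obtain ⟨hA, hY, hthr⟩ := hT
  by_contra hf
  have hf' : f ∉ LinearMap.range (Linear.leftComp k W h) := by
    rintro ⟨g, hg⟩
    exact hf ⟨g, hg.symm⟩
  -- The functional vanishes on the maps that factor through `h` but not on `f`. So `h` lies in the
  -- annihilator of `φ`, and `x` generates that annihilator.
  obtain ⟨φ, hφf, hφ⟩ := Submodule.exists_le_ker_of_notMem hf'
  obtain ⟨G, x, hx, hxu⟩ := hI.exists_generator hw φ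
  obtain ⟨c, hc⟩ := hxu h fun g => hφ ⟨g, rfl⟩
  obtain ⟨J, _, B, ι, π, hB, -, -, hsum⟩ := hdec G
  have hsplit : ∀ {Z : C} (c : G ⟶ Z), x ≫ c ≠ 0 → ∃ j, x ≫ π j ≠ 0 ∧ ι j ≫ c ≠ 0 := by
    intro Z c hc
    by_contra! hj
    apply hc
    calc x ≫ c = x ≫ (∑ j, π j ≫ ι j) ≫ c := by rw [hsum, Category.id_comp]
      _ = ∑ j, (x ≫ π j) ≫ ι j ≫ c := by
        simp only [Preadditive.sum_comp, Preadditive.comp_sum, Category.assoc]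
      _ = 0 := Finset.sum_eq_zero fun j _ => by
        by_cases h : x ≫ π j = 0
        · rw [h, zero_comp]
        · rw [hj j h, comp_zero]
  -- On bricks this is a strict order, since a nonzero composite `B i ⟶ B j ⟶ B i` would make its
  -- first factor invertible. It is well founded because `J` is finite.
  let r : J → J → Prop := fun i j => ∃ t : B i ⟶ B j, t ≠ 0 ∧ ¬ IsIso t
  have hirr : ∀ i, ¬ r i i := fun i ⟨t, ht, hti⟩ => hti ((hB i).2 t ht)
  have htrans : ∀ i j l, r i j → r j l → r i l := by
    rintro i j l ⟨s, hs, hsi⟩ ⟨t, ht, -⟩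
    refine ⟨s ≫ t, hC (hB j) s t hs ht, fun hst => hsi ?_⟩
    refine (hB i).isIso_of_comp_eq_id (hB j) (g := t ≫ inv (s ≫ t)) ?_
    rw [← Category.assoc, IsIso.hom_inv_id]
  have : Std.Irrefl r := ⟨hirr⟩
  have : IsTrans J r := ⟨htrans⟩
  have hwf : WellFounded r := Finite.wellFounded_of_trans_of_irrefl r
  obtain ⟨j, ⟨hj, hjY⟩, hmin⟩ := hwf.has_min {j | x ≫ π j ≠ 0 ∧ IsBetween A Y (B j)} (by
    obtain ⟨j, hj, hjc⟩ := hsplit c (hc ▸ h0)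
    exact ⟨j, hj, ⟨⟨_, hj⟩, _, hjc⟩⟩)
  obtain ⟨N, z, hN, hz⟩ := (hthr (B j) (hB j) hjY).2.2
  -- Were `x ≫ π j` invertible, `f` would factor through `x` and `φ f` would vanish.
  obtain ⟨y, hy⟩ := hz.2.1 (x ≫ π j) fun hs => by
    have := hA.isIso_of_isSplitEpi (hB j) hs
    have h1 := hx (π j ≫ inv (x ≫ π j) ≫ f)
    rw [← Category.assoc, IsIso.hom_inv_id_assoc] at h1
    exact hφf h1
  have hy0 : y ≠ 0 := fun h => hj (by rw [← hy, h, zero_comp])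
  have hz0 := hz.ne_zero hN
  have hNb : IsBetween A Y N := by
    obtain ⟨-, g, hg⟩ := hjY
    exact ⟨⟨y, hy0⟩, z ≫ g, hC (hB j) z g hz0 hg⟩
  -- Maps `N ⟶ W` factor through `z`, because `N` is in the thread and `W` is not. So `y` inherits
  -- from `x ≫ π j` the vanishing under `φ` and factors through `x` in turn.
  obtain ⟨c', hc'⟩ := hxu y fun g => by
    obtain ⟨g', rfl⟩ := hz.exists_comp_eq (hB j) (hthr N hN hNb) g fun hs => by
      have := hN.isIso_of_isSplitMono hW hs
      exact hWb (hNb.of_iso g)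
    rw [reassoc_of% hy]
    exact hx _
  obtain ⟨l, hl, hlc⟩ := hsplit c' (hc' ▸ hy0)
  -- The summand `B l` maps nontrivially to `N`, and so lies strictly below `B j`, contradicting
  -- minimality.
  refine hmin l ⟨hl, ⟨⟨_, hl⟩, ?_⟩⟩ ⟨(ι l ≫ c') ≫ z, hC hN _ z hlc hz0, fun hiso => hz.1 ?_⟩
  · obtain ⟨-, g, hg⟩ := hNb
    exact ⟨(ι l ≫ c') ≫ g, hC hN _ g hlc hg⟩
  · exact ⟨⟨⟨inv ((ι l ≫ c') ≫ z) ≫ ι l ≫ c', by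
      rw [Category.assoc, IsIso.inv_hom_id]⟩⟩⟩

theorem exists_reflection_of_isBrick (hC : NoZeroDivisorsAtBricks C)
    (hdec : ∀ A : C, HasBrickDecomposition A) (hI : FinPresDualHoms k C) (hw : HasWeakPushouts C)
    {I : Type w} {X Y : I → C} (hmax : ∀ i, IsMaximalBrickThread (X i) (Y i)) {A : C}
    (hA : IsBrick A) : ∃ (M : C) (η : A ⟶ M), avoids X Y M ∧
      ∀ B, avoids X Y B → ∀ f : A ⟶ B, ∃! g, η ≫ g = f := by
  by_cases h : avoids X Y A
  · exact ⟨A, 𝟙 A, h, fun B _ f => ⟨f, by simp, fun g hg => by simpa using hg⟩⟩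
  have : ∃ i, IsBetween (X i) (Y i) A := by
    by_contra! h'
    refine h fun i Z hZ hb => ⟨fun r => h' i ?_⟩
    have := hZ.isIso_of_comp_eq_id hA r.retract
    exact hb.of_iso r.i
  obtain ⟨i, hi⟩ := this
  have hX := (hmax i).1.1
  have hY := (hmax i).1.2.1
  obtain ⟨⟨a, ha⟩, h, h0⟩ := hi
  have hah := hC hA a h ha h0
  obtain ⟨-, ⟨M, y, hM, hy⟩, -⟩ := (hmax i).1.2.2 (Y i) hY ⟨⟨_, hah⟩, 𝟙 _, hY.1⟩
  have hy0 := hy.ne_zero hM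
  have hMt := (hmax i).not_isThreadBrick hC hah hy
  have hη := hC hY h y h0 hy0
  -- The part of the thread from `A` onwards is again a thread, to which the factorization lemma
  -- applies.
  have hT : IsBrickThread A (Y i) := ⟨hA, hY, fun Z hZ hb =>
    (hmax i).1.2.2 Z hZ (by simpa using hb.comp hC hA hY ha (g := 𝟙 (Y i)) hY.1)⟩
  refine ⟨M, h ≫ y, fun j Z hZ hb => ⟨fun r => hMt ?_⟩, fun B hB f => ?_⟩
  · have := hZ.isIso_of_comp_eq_id hM r.retract
    exact (hmax j).1.2.2 M hM (hb.of_iso r.i)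
  · have huniq : ∀ g g' : M ⟶ B, (h ≫ y) ≫ g = (h ≫ y) ≫ g' → g = g' := by
      intro g g' hg
      by_contra hne
      refine hC hM (h ≫ y) (g - g') hη (sub_ne_zero.2 hne) ?_
      rw [Preadditive.comp_sub, hg, sub_self]
    obtain ⟨J, _, W, ι, π, hWJ, h₁, -, hsum⟩ := hdec B
    have hWb : ∀ j, ¬ IsBetween (X i) (Y i) (W j) := fun j hb =>
      (hB i (W j) (hWJ j) hb).false ⟨ι j, π j, h₁ j⟩
    have hfac : ∀ j, ∃ g : M ⟶ W j, f ≫ π j = (h ≫ y) ≫ g := by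
      intro j
      obtain ⟨g, hg⟩ := exists_eq_comp_of_not_isBetween hC hdec hI hw hT (hWJ j)
        (fun hb => hWb j (by simpa using hb.comp hC hA hY ha (g := 𝟙 (Y i)) hY.1)) h0 (f ≫ π j)
      obtain ⟨g', rfl⟩ := hy.2.1 g fun hs => hWb j (by
        have := hY.isIso_of_isSplitMono (hWJ j) hs
        exact IsBetween.of_iso ⟨⟨_, hah⟩, 𝟙 _, hY.1⟩ g)
      exact ⟨g', by rw [hg, Category.assoc]⟩
    choose g hg using hfac
    have hgf : (h ≫ y) ≫ ∑ j, g j ≫ ι j = f := by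
      calc _ = ∑ j, ((h ≫ y) ≫ g j) ≫ ι j := by
            simp only [Preadditive.comp_sum, Category.assoc]
        _ = f ≫ ∑ j, π j ≫ ι j := by
            simp only [← hg, Preadditive.comp_sum, Category.assoc]
        _ = f := by rw [hsum, Category.comp_id]
    exact ⟨_, hgf, fun g' hg' => huniq _ _ (hg'.trans hgf.symm)⟩

theorem avoids_biproduct {I : Type w} {X Y : I → C} {J : Type} [Fintype J] [HasFiniteBiproducts C]
    {L : J → C} (hL : ∀ j, avoids X Y (L j)) : avoids X Y (⨁ L) := by
  intro i Z hZ hb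
  refine ⟨fun r => ?_⟩
  classical
  obtain ⟨j, ⟨s⟩⟩ := hZ.exists_retract_of_sum (biproduct.ι L) (biproduct.π L) biproduct.total r
  exact (hL j i Z hZ hb).false s

theorem exists_reflection (hC : NoZeroDivisorsAtBricks C) [HasFiniteBiproducts C]
    (hdec : ∀ A : C, HasBrickDecomposition A) (hI : FinPresDualHoms k C) (hw : HasWeakPushouts C)
    {I : Type w} {X Y : I → C} (hmax : ∀ i, IsMaximalBrickThread (X i) (Y i)) (A : C) :
    ∃ (M : C) (η : A ⟶ M), avoids X Y M ∧
      ∀ B, avoids X Y B → ∀ f : A ⟶ B, ∃! g, η ≫ g = f := by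
  obtain ⟨J, _, D, ι, π, hD, h₁, h₂, hsum⟩ := hdec A
  choose L η hL hη using fun j => exists_reflection_of_isBrick hC hdec hI hw hmax (hD j)
  refine ⟨⨁ L, ∑ j, π j ≫ η j ≫ biproduct.ι L j, avoids_biproduct hL, fun B hB f => ?_⟩
  have hι : ∀ l, ι l ≫ ∑ j, π j ≫ η j ≫ biproduct.ι L j = η l ≫ biproduct.ι L l := by
    intro l
    rw [Preadditive.comp_sum, Finset.sum_eq_single l]
    · rw [reassoc_of% (h₁ l)]
    · intro j _ hj
      rw [reassoc_of% (h₂ l j hj.symm), zero_comp]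
    · simp
  choose g hg _ using fun j => hη j B hB (ι j ≫ f)
  refine ⟨biproduct.desc g, ?_, fun g' hg' => ?_⟩
  · calc (∑ j, π j ≫ η j ≫ biproduct.ι L j) ≫ biproduct.desc g = ∑ j, π j ≫ ι j ≫ f := by
          rw [Preadditive.sum_comp]
          refine Finset.sum_congr rfl fun j _ => ?_
          simp [hg]
      _ = (∑ j, π j ≫ ι j) ≫ f := by simp only [Preadditive.sum_comp, Category.assoc]
      _ = f := by rw [hsum, Category.id_comp]
  · apply biproduct.hom_ext'
    intro j
    refine (hη j B hB (ι j ≫ f)).unique ?_ ?_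
    · rw [← Category.assoc, ← hι, Category.assoc, hg']
    · rw [biproduct.ι_desc, hg]

end Threads

/-! ### From indecomposables and intervals to bricks -/

section Comparison

variable {C : Type u} [Category.{v} C] [Preadditive C] [HasBinaryBiproducts C]

theorem interval_le_iff (h : ∀ X : C, Indecomposable X ↔ IsBrick X) {X Y X' Y' : C} :
    interval X Y ≤ interval X' Y' ↔ ∀ Z, IsBrick Z → IsBetween X Y Z → IsBetween X' Y' Z := by
  constructor
  · intro hle Z hZ hb
    refine hle Z (fun W hW ⟨r⟩ => ?_) Z ((h Z).2 hZ) ⟨Retract.refl Z⟩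
    have := ((h W).1 hW).isIso_of_comp_eq_id hZ r.retract
    exact hb.of_iso (inv r.i)
  · intro hle A hA Z hZ hr
    exact hle Z ((h Z).1 hZ) (hA Z hZ hr)

theorem interval_iff_isBetween (h : ∀ X : C, Indecomposable X ↔ IsBrick X) {X Y Z : C}
    (hZ : IsBrick Z) : interval X Y Z ↔ IsBetween X Y Z := by
  refine ⟨fun hi => hi Z ((h Z).2 hZ) ⟨Retract.refl Z⟩, fun hb W hW ⟨r⟩ => ?_⟩
  have := ((h W).1 hW).isIso_of_comp_eq_id hZ r.retract
  exact hb.of_iso (inv r.i)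

theorem isThreadObject_iff (h : ∀ X : C, Indecomposable X ↔ IsBrick X) {X : C} :
    IsThreadObject X ↔ IsThreadBrick X := by
  simp only [IsThreadObject, IsThreadBrick, h]

theorem isThread_iff (h : ∀ X : C, Indecomposable X ↔ IsBrick X) {X Y : C} :
    IsThread X Y ↔ IsBrickThread X Y := by
  simp only [IsThread, IsBrickThread, h, isThreadObject_iff h]
  refine and_congr_right fun _ => and_congr_right fun _ => forall_congr' fun Z =>
    forall_congr' fun hZ => ?_
  rw [interval_iff_isBetween h hZ]

theorem IsMaximalThread.isMaximalBrickThread (h : ∀ X : C, Indecomposable X ↔ IsBrick X) {X Y : C}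
    (hXY : IsMaximalThread X Y) : IsMaximalBrickThread X Y :=
  ⟨(isThread_iff h).1 hXY.1, fun X' Y' ht hle => (interval_le_iff h).1
    (hXY.2 X' Y' ((isThread_iff h).2 ht) ((interval_le_iff h).2 hle))⟩

theorem withoutSummandsIn_eq_avoids (h : ∀ X : C, Indecomposable X ↔ IsBrick X) {I : Type w}
    (X Y : I → C) : withoutSummandsIn X Y = avoids X Y := by
  ext A
  simp only [withoutSummandsIn, avoids, h]
  refine forall_congr' fun i => forall_congr' fun Z => forall_congr' fun hZ => ?_
  rw [interval_iff_isBetween h hZ]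

end Comparison

/-! ### Adjoints of the inclusion from universal arrows -/

section Adjoints

variable {C : Type u} [Category.{v} C] (P : ObjectProperty C)

theorem isRightAdjoint_ι_of_exists_reflection
    (h : ∀ A : C, ∃ (M : C) (η : A ⟶ M), P M ∧ ∀ B, P B → ∀ f : A ⟶ B, ∃! g, η ≫ g = f) :
    P.ι.IsRightAdjoint := by
  have : ∀ A, HasInitial (StructuredArrow A P.ι) := by
    intro A
    obtain ⟨M, η, hM, hu⟩ := h A
    choose g hg hg' using hu
    refine (IsInitial.ofUniqueHom (X := StructuredArrow.mk (Y := (⟨M, hM⟩ : P.FullSubcategory)) η)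
      (fun B => StructuredArrow.homMk (ObjectProperty.homMk (g _ B.right.property B.hom))
        (hg _ B.right.property B.hom)) fun B m => ?_).hasInitial
    ext
    exact hg' _ B.right.property B.hom _ (StructuredArrow.w m)
  exact isRightAdjointOfStructuredArrowInitials P.ι

theorem isLeftAdjoint_ι_of_exists_coreflection
    (h : ∀ A : C, ∃ (M : C) (ε : M ⟶ A), P M ∧ ∀ B, P B → ∀ f : B ⟶ A, ∃! g, g ≫ ε = f) :
    P.ι.IsLeftAdjoint := by
  have : ∀ A, HasTerminal (CostructuredArrow P.ι A) := by
    intro A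
    obtain ⟨M, ε, hM, hu⟩ := h A
    choose g hg hg' using hu
    refine (IsTerminal.ofUniqueHom
      (Y := CostructuredArrow.mk (Y := (⟨M, hM⟩ : P.FullSubcategory)) ε)
      (fun B => CostructuredArrow.homMk (ObjectProperty.homMk (g _ B.left.property B.hom))
        (hg _ B.left.property B.hom)) fun B m => ?_).hasTerminal
    ext
    exact hg' _ B.left.property B.hom _ (CostructuredArrow.w m)
  exact isLeftAdjoint_of_costructuredArrowTerminals P.ι

end Adjoints

/-! ### The remaining objects form a finite variety -/

section FullSubcategories

variable {C : Type u} [Category.{v} C] [Preadditive C]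

theorem avoids_of_retract {I : Type w} {X Y : I → C} {A B : C} (hB : avoids X Y B)
    (r : Retract A B) : avoids X Y A :=
  fun i Z hZ hb => ⟨fun s => (hB i Z hZ hb).false (s.trans r)⟩

theorem hasFiniteBiproducts_avoids [HasFiniteBiproducts C] {I : Type w} (X Y : I → C) :
    HasFiniteBiproducts (avoids X Y).FullSubcategory := by
  have : (avoids X Y).IsClosedUnderFiniteProducts := by
    refine ⟨fun J _ => ⟨?_⟩⟩
    rintro A ⟨p⟩
    have := Fintype.ofFinite J
    have h := avoids_biproduct fun j : J => p.prop_diag_obj ⟨j⟩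
    have e : A ≅ ⨁ fun j : J => p.diag.obj ⟨j⟩ :=
      IsLimit.conePointsIsoOfNatIso p.isLimit (biproduct.isLimit _) Discrete.natIsoFunctor
    exact avoids_of_retract h e.retract
  exact HasFiniteBiproducts.of_hasFiniteProducts

variable {k : Type v} [Field k] [Linear k C]

theorem IsFiniteVariety.avoids (hC : IsFiniteVariety k C) {I : Type w} (X Y : I → C) :
    IsFiniteVariety k (avoids X Y).FullSubcategory := by
  have := hC.hasFiniteBiproducts
  refine ⟨hasFiniteBiproducts_avoids X Y, ⟨fun A p hp => ?_⟩, fun A B => ?_⟩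
  · obtain ⟨Z, i, r, hir, hri⟩ :=
      hC.isIdempotentComplete.idempotents_split A.obj p.hom (congrArg (fun t => t.hom) hp)
    refine ⟨⟨Z, avoids_of_retract A.property ⟨i, r, hir⟩⟩, ObjectProperty.homMk i,
      ObjectProperty.homMk r, ?_, ?_⟩
    · ext1
      exact hir
    · ext1
      exact hri
  · have : Module.Finite k ((DualizingVariety.avoids X Y).ι.obj A ⟶
        (DualizingVariety.avoids X Y).ι.obj B) := hC.finite_hom A.obj B.obj
    exact Module.Finite.of_injective
      ((DualizingVariety.avoids X Y).ι.mapLinearMap k : (A ⟶ B) →ₗ[k] _)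
      (DualizingVariety.avoids X Y).ι.map_injective

end FullSubcategories

end DualizingVariety
end

/-! ### The main theorem -/

open DualizingVariety in
theorem mainTheorem11 (k : Type v) [Field k] [IsAlgClosed k]
    (C : Type u) [Category.{v} C] [Preadditive C] [Linear k C] [HasBinaryBiproducts C]
    (hsh : IsSemiHereditary k C) (hdual : IsDualizing k C)
    {I : Type w} (X Y : I → C) (hmax : ∀ i, IsMaximalThread (X i) (Y i)) :
    IsSemiHereditary k (withoutSummandsIn X Y).FullSubcategory ∧
      IsDualizing k (withoutSummandsIn X Y).FullSubcategory ∧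
      (withoutSummandsIn X Y).ι.IsLeftAdjoint ∧
      (withoutSummandsIn X Y).ι.IsRightAdjoint := by
  have hfin := hdual.1
  have := hfin.hasFiniteBiproducts
  have := hfin.isIdempotentComplete
  have hR := hsh.isRickart
  have hind : ∀ X : C, Indecomposable X ↔ IsBrick X := fun X =>
    ⟨Indecomposable.isBrick hR hfin.finite_hom, IsBrick.indecomposable⟩
  have hdec := hasBrickDecomposition_of_indecomposable_isBrick hfin.finite_hom
    fun X => (hind X).1
  have hNZ := hR.noZeroDivisorsAtBricks
  have hw := hdual.hasWeakPushouts hsh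
  have hw' := hR.hasWeakPushouts_op
  have hI := hdual.finPresDualHoms
  have hI' := hdual.finPresDualHoms_op
  have hmax' := fun i => (hmax i).isMaximalBrickThread hind
  rw [withoutSummandsIn_eq_avoids hind]
  have hright : (avoids X Y).ι.IsRightAdjoint :=
    isRightAdjoint_ι_of_exists_reflection _ (exists_reflection hNZ hdec hI hw hmax')
  have hleft : (avoids X Y).ι.IsLeftAdjoint := by
    refine isLeftAdjoint_ι_of_exists_coreflection _ fun A => ?_
    have : HasFiniteBiproducts Cᵒᵖ := HasFiniteBiproducts.of_hasFiniteProducts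
    obtain ⟨M, η, hM, hu⟩ := exists_reflection hNZ.op (fun A => (hdec A.unop).op) hI' hw'
      (fun i => (hmax' i).op) (op A)
    refine ⟨M.unop, η.unop, avoids_op_iff.1 hM, fun B hB f => ?_⟩
    obtain ⟨g, hg, hg'⟩ := hu (op B) (avoids_op_iff.2 hB) f.op
    exact ⟨g.unop, congrArg Quiver.Hom.unop hg, fun t ht =>
      congrArg Quiver.Hom.unop (hg' t.op (congrArg Quiver.Hom.op ht))⟩
  have hfinb := hfin.avoids X Y
  have := hfinb.hasFiniteBiproducts
  have := hfinb.isIdempotentComplete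
  have := hasBinaryBiproducts_of_finite_biproducts (avoids X Y).FullSubcategory
  -- The empty sum is an object even if every brick is removed; some object is needed to present the
  -- zero module.
  have hne : Nonempty (avoids X Y).FullSubcategory := ⟨⨁ (Empty.elim : Empty → _)⟩
  have hop : (avoids X Y).ι.op.IsRightAdjoint :=
    ((Adjunction.ofIsLeftAdjoint (avoids X Y).ι).op).isRightAdjoint
  have hwb := hw.of_isRightAdjoint (avoids X Y).ι
  have hwb' := hw'.of_isRightAdjoint (avoids X Y).ι.op
  refine ⟨(hR.of_fullyFaithful (avoids X Y).ι).isSemiHereditary hwb', ?_, hleft, hright⟩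
  exact isDualizing_of_finPresDualHoms hfinb (hI.of_isRightAdjoint (avoids X Y).ι)
    (hI'.of_isRightAdjoint (avoids X Y).ι.op) hwb hwb'
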